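/- Let $\mathbb P^*$ be the set of all finite words over the positive integers, with empty word $\epsilon$, and let $\{1,2\}^*\subseteq\mathbb P^*$ be the words in the letters $1,2$. For $w=a_1\cdots a_n$ put $\mathrm{Des}\,w=\{i: 1\le i<n,\ a_i>a_{i+1}\}$, $\mathrm{des}\,w=|\mathrm{Des}\,w|$, $\mathrm{maj}\,w=\sum_{i\in\mathrm{Des}\,w}i$, and $\mathrm{inv}\,w=|\{(i,j): i<j,\ a_i>a_j\}|$. A word $v\in\{1,2\}^*$ with $d$ descents is uniquely of the form $1^{m_0}2^{n_0}1^{m_1}2^{n_1}\cdots1^{m_d}2^{n_d}$ with $m_0,n_d\ge0$ and all other exponents positive; put $e(v)=\max_{0\le i\le d}\big((n_0+\cdots+n_i)-(m_0+\cdots+m_i)\big)$. Foata's bijection $\phi:\mathbb P^*\to\mathbb P^*$ is given by $\phi(\epsilon)=\epsilon$ and, for $v=a_1\cdots a_n$ with $n\ge1$, by $\phi(v)=w_n$, where $w_1=a_1$, and $w_{i+1}$ is obtained from $w_i=b_1\cdots b_i$ as follows. Factor $w_i=f_1\cdots f_k$ so that, if $b_i\le a_{i+1}$ (respectively $b_i>a_{i+1}$),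 the last letter of each factor is $\le a_{i+1}$ (respectively $>a_{i+1}$) and all its other letters are $>a_{i+1}$ (respectively $\le a_{i+1}$). Let $g_j$ be $f_j$ with its last letter moved to the front, and let $w_{i+1}=g_1\cdots g_k a_{i+1}$. Let $P$ be the set of all integer partitions, including the empty one. For $\lambda\in P$ let $|\lambda|$ be its size, $\lambda'$ its conjugate, $d(\lambda)$ the side of its Durfee square, $r_i(\lambda)=\lambda_i-\lambda_i'$ for $1\le i\le d(\lambda)$ its ranks, and $r(\lambda)=\max_{1\le i\le d(\lambda)}r_i(\lambda)$, with $r(\emptyset)=-1$. Let $w(\lambda)\in\{1,2\}^*$ be the word recording the north steps (as $1$) and the east steps (as $2$) along the southeast boundary of the Ferrers diagram of $\lambda$, from its lower left to its upper right corner. A set of partitions is identified with the set of words $w(\lambda)$ of its members where a set of words is required. Put $R_{\ge1}=\{\lambda\in P: r_i(\lambda)\ge1 \text{ for all } 1\le i\le d(\lambda)\}$, $P_{\ne1}=\{\lambda\in P: \lambda \text{ has no part } 1\}$, and $\Lambda'=\{\lambda':\lambda\in\Lambda\}$ for $\Lambda\subseteq P$. Let $W_v=\{1,2\}^*v\cup\{\epsilon\}$,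 and let $B_v$ be the set of ballot sequences in $W_v$, that is, of words in every prefix of which each $i\ge1$ occurs at least as often as $i+1$. Call a pair $(S,T)$ of subsets of $\mathbb P^*$ Mahonian if there is a bijection $\alpha:S\to T$ with $\mathrm{maj}\,v=\mathrm{inv}\,\alpha(v)$ for all $v\in S$. **Theorem.** We have $$\phi^{-1}(P)=W_{21},\qquad \phi^{-1}(R_{\ge1}')=B_{21},\qquad \phi^{-1}(P_{\ne1}')=W_{121}.$$ The pairs $(S,T)=(W_{21},P)$, $(B_{21},R_{\ge1}')$ and $(W_{121},P_{\ne1}')$ are Mahonian, and for each of them $$\sum_{v\in S}q^{\mathrm{maj}\,v}t^{\mathrm{des}\,v}z^{e(v)}=\sum_{\lambda\in T}q^{|\lambda|}t^{d(\lambda)}z^{r(\lambda)+1}$$ as formal power series in $q$ with coefficients in $\mathbb Z[t,z,z^{-1}]$; both sums converge, because for each $n$ there are only finitely many $v\in S$ with $\mathrm{maj}\,v=n$ and only finitely many $\lambda\in T$ with $|\lambda|=n$. Moreover, as formal power series, $$\sum_{w\in B_{21}}q^{\mathrm{maj}\,w}=\sum_{w\in W_{121}}q^{\mathrm{maj}\,w}=\prod_{i\ge2}\frac1{1-q^i}.$$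 -/

import Mathlib

open scoped Polynomial LaurentPolynomial PowerSeries PowerSeries.WithPiTopology

namespace MahonianPairs

/-- Words over the positive integers. The empty word is `[]`. -/
abbrev Word := List ℕ+

/-! ### Statistics on words -/

/-- The descent set `{i : 1 ≤ i < n, a_i > a_{i+1}}` of `a_1 ⋯ a_n`. Letters are numbered from `1`
here, so that `a_i` is the list entry with index `i - 1`; the default value of `getD` is never
used. -/
def desSet (w : Word) : Finset ℕ :=
  (Finset.Ico 1 w.length).filter fun i => w.getD i 1 < w.getD (i - 1) 1

/-- The major index. -/
def maj (w : Word) : ℕ := ∑ i ∈ desSet w, i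

/-- The number of descents. -/
def des (w : Word) : ℕ := (desSet w).card

/-- The number of inversions (the default value of `getD` is never used). -/
def inv (w : Word) : ℕ :=
  ((Finset.range w.length ×ˢ Finset.range w.length).filter fun p =>
    p.1 < p.2 ∧ w.getD p.2 1 < w.getD p.1 1).card

/-- The excess of the number of twos over the number of ones. -/
def excess (w : Word) : ℤ := (w.count 2 : ℤ) - (w.count 1 : ℤ)

/-- The statistic `e`. A word in `{1,2}*` with `d` descents is uniquely
`1^{m_0} 2^{n_0} 1^{m_1} 2^{n_1} ⋯ 1^{m_d} 2^{n_d}` with only `m_0` and `n_d` allowed to vanish,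
and `e` is the maximum over `0 ≤ i ≤ d` of `e_i = (n_0 + ⋯ + n_i) - (m_0 + ⋯ + m_i)`.
The prefixes `1^{m_0} 2^{n_0} ⋯ 1^{m_i} 2^{n_i}` are those that end at a descent (for `i < d`)
and the whole word (for `i = d`). -/
def e (w : Word) : ℤ :=
  (insert w.length (desSet w)).sup' (Finset.insert_nonempty _ _) fun k => excess (w.take k)

/-! ### Foata's fundamental bijection -/

/-- The factorization of a word in which every factor ends with a letter satisfying `p` and
contains no other letter satisfying `p` (provided the word itself ends with such a letter). -/
def factors (p : ℕ+ → Bool) : Word → List Word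
  | [] => []
  | x :: xs =>
    if p x then [x] :: factors p xs
    else
      match factors p xs with
      | [] => [[x]]
      | f :: fs => (x :: f) :: fs

/-- The cyclic shift bringing the last letter to the front. -/
def cyclicShift (f : Word) : Word := f.rotate (f.length - 1)

/-- One step of Foata's construction: from `w_i` and the letter `a = a_{i+1}` to `w_{i+1}`. -/
def foataStep (w : Word) (a : ℕ+) : Word :=
  match w.getLast? with
  | none => [a]
  | some b =>
    ((factors (fun x => if b ≤ a then decide (x ≤ a) else decide (a < x)) w).map
      cyclicShift).flatten ++ [a]

/-- Foata's fundamental bijection `φ`. -/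
def foata (v : Word) : Word := v.foldl foataStep []

/-! ### Sets of words -/

/-- The words with letters in `{1,2}`. -/
def IsBinary (w : Word) : Prop := ∀ a ∈ w, a = 1 ∨ a = 2

/-- `W_v = {1,2}* v ⊎ {ε}`. -/
def W (v : Word) : Set Word := {w | ∃ u, IsBinary u ∧ w = u ++ v} ∪ {[]}

/-- Ballot sequences. -/
def IsBallot (w : Word) : Prop := ∀ v, v <+: w → ∀ i : ℕ+, v.count (i + 1) ≤ v.count i

/-- `B_v`, the set of ballot sequences in `W_v`. -/
def B (v : Word) : Set Word := {w | w ∈ W v ∧ IsBallot w}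

/-- Mahonian pairs of sets of words, of any cardinality. -/
def IsMahonianPair (S T : Set Word) : Prop :=
  ∃ α : S ≃ T, ∀ v : S, maj (v : Word) = inv (α v : Word)

/-! ### Integer partitions

Partitions are represented by their Ferrers diagrams (`YoungDiagram`). Rows and columns are
numbered from `0`, so the parts are `λ_{i+1} = l.rowLen i`, and `λ'_{i+1} = l.colLen i`.
The size `|λ|` is `l.card` and the conjugate is `l.transpose`. -/

/-- The word `w(λ) = 2^{λ_k} 1 2^{λ_{k-1} - λ_k} 1 ⋯ 2^{λ_1 - λ_2} 1` (with `k` the number of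
parts), recording the north steps (`1`) and east steps (`2`) along the southeast boundary of the
Ferrers diagram from its lower left to its upper right corner. -/
def boundaryWord (l : YoungDiagram) : Word :=
  (List.range (l.colLen 0)).reverse.flatMap fun i =>
    List.replicate (l.rowLen i - l.rowLen (i + 1)) 2 ++ [1]

/-- The side `d(λ)` of the Durfee square: the largest `d` with `(d^d) ⊆ λ`. It is at most the
number of parts, which serves as the bound of the search. -/
def durfee (l : YoungDiagram) : ℕ :=
  Nat.findGreatest (fun d => Finset.range d ×ˢ Finset.range d ⊆ l.cells) (l.colLen 0)

/-- The rank `r_{i+1}(λ) = λ_{i+1} - λ'_{i+1}`. -/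
def rank (l : YoungDiagram) (i : ℕ) : ℤ := (l.rowLen i : ℤ) - (l.colLen i : ℤ)

/-- The maximum rank `r(λ) = max_{1 ≤ i ≤ d(λ)} r_i(λ)`, with the convention `r(∅) = -1` for the
empty partition, which has no ranks. -/
def maxRank (l : YoungDiagram) : ℤ :=
  if h : (Finset.range (durfee l)).Nonempty then (Finset.range (durfee l)).sup' h (rank l) else -1

/-- `R_{≥ t}`, the partitions with all ranks at least `t`. -/
def RGe (t : ℤ) : Set YoungDiagram := {l | ∀ i < durfee l, t ≤ rank l i}

/-- `P_{≠ t}`, the partitions with no part equal to `t`. -/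
def PNe (t : ℕ) : Set YoungDiagram := {l | t ∉ l.rowLens}

/-- `Λ' = {λ' : λ ∈ Λ}`. -/
def conj (L : Set YoungDiagram) : Set YoungDiagram := YoungDiagram.transpose '' L

/-! ### Generating functions -/

/-- The formal power series `∑_{x ∈ S} q^{deg x} wt(x)` in `q`. It is meaningful when `S` has
finitely many elements of each degree, see `Converges`. -/
noncomputable def genFun {A R : Type*} [CommRing R] (S : Set A) (deg : A → ℕ) (wt : A → R) :
    R⟦X⟧ :=
  PowerSeries.mk fun n => ∑ᶠ x ∈ {x | x ∈ S ∧ deg x = n}, wt x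

/-- The sum `∑_{x ∈ S} q^{deg x} wt(x)` converges as a formal series:
`S` has finitely many elements of each degree. -/
def Converges {A : Type*} (S : Set A) (deg : A → ℕ) : Prop :=
  ∀ n, {x | x ∈ S ∧ deg x = n}.Finite

/-- The monomial `t^a z^c`, with `a` a natural number and `c` an integer, in `ℤ[z, z⁻¹][t]`. -/
noncomputable def tz (a : ℕ) (c : ℤ) : ℤ[T;T⁻¹][X] :=
  Polynomial.C (LaurentPolynomial.T c) * Polynomial.X ^ a

end MahonianPairs

open MahonianPairs

namespace MahonianPairs

/-! ### Descents and inversions of extended words -/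

/-! On binary words Foata's map obeys a short recursion: `foata (v2) = foata v · 2`, `foata (v11) =
1 · foata (v1)` and `foata (v21) = 2 · foata v · 1`. Read the image as a lattice path bounding a
Ferrers diagram. A final 2 or an initial 1 leaves the diagram alone, while passing from `u` to `2u1`
wraps a hook around the diagram of `u`, with first row one longer than the number of twos in `u` and
first column one longer than the number of ones. Only the step `v21` creates a descent, so descents
correspond to diagonal hooks and `des` becomes the Durfee side. The new first rank is the excess of
`v`, and the prefix `v2` ending at the new descent has excess one larger; the old ranks only move
down the diagonal. Hence the excesses at descents are exactly the ranks plus one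
(`image_excess_desSet`), while `inv_foata` and `card_diagram` turn `maj` into size.

Everything about the three pairs follows. Nonempty boundary words are exactly the words `2u1`, whose
preimages are the words `x21`. A word in `W_21` is a ballot sequence iff its excesses at descents
are at most 0, that is, iff all ranks are at most -1, which is the condition on the conjugate. The
conjugate has no part 1 iff the two top rows are equal (possibly both empty), that is, iff the word
is empty or has a 1 before its final 21.

For the product, `W_121` corresponds to partitions without part 1, whose generating function is
classical. The series of `B_21` is compared with it through `W_21`: both complements `W_21 \ B_21`
and `W_21 \ W_121` are images of `W_21` under injections raising `maj` by one (`bijOn_raise`,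
`bijOn_double_last_two`), so both series equal `(1 - q)` times that of `W_21`. -/

theorem desSet_nil : desSet [] = ∅ := by simp [desSet]

theorem desSet_singleton (a : ℕ+) : desSet [a] = ∅ := by simp [desSet]

theorem lt_length_of_mem_desSet {w : Word} {k : ℕ} (h : k ∈ desSet w) : k < w.length := by
  simp only [desSet, Finset.mem_filter, Finset.mem_Ico] at h
  exact h.1.2

theorem desSet_append_pair (w : Word) (b a : ℕ+) :
    desSet (w ++ [b, a]) =
      if a < b then insert (w.length + 1) (desSet (w ++ [b])) else desSet (w ++ [b]) := by
  have key : ∀ k, k ∈ desSet (w ++ [b, a]) ↔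
      (k = w.length + 1 ∧ a < b) ∨ k ∈ desSet (w ++ [b]) := by
    intro k
    simp only [desSet, Finset.mem_filter, Finset.mem_Ico, List.length_append, List.length_cons,
      List.length_nil]
    rcases lt_trichotomy k (w.length + 1) with h | h | h
    · have h1 : (w ++ [b, a]).getD k 1 = (w ++ [b]).getD k 1 := by
        rw [show w ++ [b, a] = (w ++ [b]) ++ [a] by simp, List.getD_append]
        simpa using h
      have h2 : (w ++ [b, a]).getD (k - 1) 1 = (w ++ [b]).getD (k - 1) 1 := by
        rw [show w ++ [b, a] = (w ++ [b]) ++ [a] by simp, List.getD_append]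
        simp; omega
      rw [h1, h2]
      constructor
      · rintro ⟨⟨h3, h4⟩, h5⟩
        exact Or.inr ⟨⟨h3, by omega⟩, h5⟩
      · rintro (⟨h3, -⟩ | ⟨⟨h3, h4⟩, h5⟩)
        · omega
        · exact ⟨⟨h3, by omega⟩, h5⟩
    · subst h
      simp [List.getD_eq_getElem?_getD]
    · constructor
      · rintro ⟨⟨h3, h4⟩, h5⟩
        omega
      · rintro (⟨h3, -⟩ | ⟨⟨h3, h4⟩, h5⟩) <;> omega
  ext k
  rw [key]
  split_ifs with h <;> simp [h]

theorem desSet_append_two {w : Word} (hw : IsBinary w) : desSet (w ++ [2]) = desSet w := by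
  rcases List.eq_nil_or_concat w with rfl | ⟨u, b, rfl⟩
  · simp [desSet_nil, desSet_singleton]
  · have hb : ¬ (2 : ℕ+) < b := by
      rcases hw b (by simp) with rfl | rfl <;> decide
    simp [desSet_append_pair, hb]

theorem desSet_append_one_one (w : Word) : desSet (w ++ [1, 1]) = desSet (w ++ [1]) := by
  simp [desSet_append_pair]

theorem isBinary_append {u v : Word} : IsBinary (u ++ v) ↔ IsBinary u ∧ IsBinary v := by
  simp only [IsBinary, List.mem_append]
  exact ⟨fun h => ⟨fun a ha => h a (.inl ha), fun a ha => h a (.inr ha)⟩,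
    fun h a ha => ha.elim (h.1 a) (h.2 a)⟩

theorem isBinary_nil : IsBinary [] := by simp [IsBinary]
theorem isBinary_one : IsBinary [1] := by simp [IsBinary]
theorem isBinary_two : IsBinary [2] := by simp [IsBinary]

theorem isBinary_one_one : IsBinary [1, 1] := by simp [IsBinary]

theorem isBinary_two_one : IsBinary [2, 1] := by simp [IsBinary]

theorem isBinary_cons {a : ℕ+} {v : Word} :
    IsBinary (a :: v) ↔ (a = 1 ∨ a = 2) ∧ IsBinary v := by
  simp [IsBinary]

theorem desSet_append_two_one {w : Word} (hw : IsBinary w) :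
    desSet (w ++ [2, 1]) = insert (w.length + 1) (desSet w) := by
  have : (1 : ℕ+) < 2 := by decide
  rw [desSet_append_pair, if_pos this, desSet_append_two hw]

theorem length_succ_notMem_desSet (w : Word) : w.length + 1 ∉ desSet w := fun h => by
  have := lt_length_of_mem_desSet h
  omega

theorem maj_append_two_one {w : Word} (hw : IsBinary w) :
    maj (w ++ [2, 1]) = maj w + (w.length + 1) := by
  rw [maj, desSet_append_two_one hw, Finset.sum_insert (length_succ_notMem_desSet w), maj,
    add_comm]

theorem des_append_two_one {w : Word} (hw : IsBinary w) :
    des (w ++ [2, 1]) = des w + 1 := by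
  rw [des, desSet_append_two_one hw, Finset.card_insert_of_notMem (length_succ_notMem_desSet w),
    des]

theorem inv_cons (a : ℕ+) (w : Word) : inv (a :: w) = w.countP (· < a) + inv w := by
  have hc : ∀ w : Word, w.countP (· < a) =
      ∑ j ∈ Finset.range w.length, if w.getD j 1 < a then 1 else 0 := by
    intro w
    induction w with
    | nil => simp
    | cons b w ih =>
      rw [List.length_cons, Finset.sum_range_succ', List.countP_cons, ih]
      simp
  simp only [inv, Finset.card_filter, Finset.sum_product]
  rw [hc, List.length_cons, Finset.sum_range_succ']
  simp only [Finset.sum_range_succ' _ w.length]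
  simp
  rw [add_comm]

theorem inv_append_singleton (w : Word) (a : ℕ+) :
    inv (w ++ [a]) = inv w + w.countP (a < ·) := by
  induction w with
  | nil => simp [inv]
  | cons b w ih =>
    rw [List.cons_append, inv_cons, inv_cons, ih, List.countP_append, List.countP_cons]
    simp only [List.countP_cons, List.countP_nil]
    omega

theorem countP_one_lt {w : Word} (hw : IsBinary w) : w.countP (1 < ·) = w.count 2 := by
  rw [List.count]
  refine List.countP_congr fun x hx => ?_
  rcases hw x hx with rfl | rfl <;> decide

theorem countP_lt_two {w : Word} (hw : IsBinary w) : w.countP (· < 2) = w.count 1 := by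
  rw [List.count]
  refine List.countP_congr fun x hx => ?_
  rcases hw x hx with rfl | rfl <;> decide

theorem length_eq_count_add_count {w : Word} (hw : IsBinary w) :
    w.length = w.count 1 + w.count 2 := by
  induction w with
  | nil => simp
  | cons a w ih =>
    rw [isBinary_cons] at hw
    rcases hw.1 with rfl | rfl <;> simp [ih hw.2] <;> omega

theorem inv_append_two {w : Word} (hw : IsBinary w) : inv (w ++ [2]) = inv w := by
  rw [inv_append_singleton, List.countP_eq_zero.2, add_zero]
  intro x hx
  rcases hw x hx with rfl | rfl <;> decide

theorem inv_append_one {w : Word} (hw : IsBinary w) : inv (w ++ [1]) = inv w + w.count 2 := by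
  rw [inv_append_singleton, countP_one_lt hw]

theorem inv_one_cons (w : Word) : inv (1 :: w) = inv w := by
  rw [inv_cons, List.countP_eq_zero.2, zero_add]
  simp

/-- Induction over binary words along the steps of Foata's construction. -/
theorem IsBinary.induction {C : (v : Word) → IsBinary v → Prop} (nil : C [] isBinary_nil)
    (one : C [1] isBinary_one)
    (two : ∀ v hv, C v hv → C (v ++ [2]) (isBinary_append.2 ⟨hv, isBinary_two⟩))
    (one_one : ∀ v hv, C (v ++ [1]) (isBinary_append.2 ⟨hv, isBinary_one⟩) →
      C (v ++ [1, 1]) (isBinary_append.2 ⟨hv, isBinary_one_one⟩))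
    (two_one : ∀ v hv, C v hv → C (v ++ [2, 1]) (isBinary_append.2 ⟨hv, isBinary_two_one⟩))
    (v : Word) (hv : IsBinary v) : C v hv := by
  induction h : v.length using Nat.strong_induction_on generalizing v with
  | _ n ih =>
    subst h
    rcases List.eq_nil_or_concat v with rfl | ⟨x, a, rfl⟩
    · exact nil
    · simp only [List.concat_eq_append, isBinary_append, isBinary_cons] at hv ⊢
      rcases hv.2.1 with rfl | rfl
      · rcases List.eq_nil_or_concat x with rfl | ⟨y, b, rfl⟩
        · exact one
        · simp only [List.concat_eq_append, isBinary_append, isBinary_cons] at hv ⊢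
          rcases hv.1.2.1 with rfl | rfl
          · have := one_one y hv.1.1 (ih _ (by simp) (y ++ [1])
              (isBinary_append.2 ⟨hv.1.1, isBinary_one⟩) rfl)
            simpa using this
          · have := two_one y hv.1.1 (ih _ (by simp) y hv.1.1 rfl)
            simpa using this
      · exact two x hv.1 (ih _ (by simp) x hv.1 rfl)

/-! ### Foata's bijection on binary words -/

theorem foata_append_singleton (v : Word) (a : ℕ+) : foata (v ++ [a]) = foataStep (foata v) a := by
  simp [foata]

theorem factors_flatten (p : ℕ+ → Bool) (w : Word) : (factors p w).flatten = w := by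
  induction w with
  | nil => simp [factors]
  | cons x xs ih =>
    rw [factors]
    split_ifs
    · simp [ih]
    · split <;> rename_i h <;> rw [h] at ih <;> simp_all

theorem cyclicShift_perm (f : Word) : (cyclicShift f).Perm f := List.rotate_perm _ _

theorem flatten_map_perm {g : Word → Word} (hg : ∀ f, (g f).Perm f) (L : List Word) :
    (L.map g).flatten.Perm L.flatten := by
  induction L with
  | nil => simp
  | cons f L ih => simpa using (hg f).append ih

theorem foataStep_perm (w : Word) (a : ℕ+) : (foataStep w a).Perm (w ++ [a]) := by
  rw [foataStep]
  split
  · rename_i h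
    simp_all
  · rename_i b h
    refine List.Perm.append_right _ ?_
    have := flatten_map_perm cyclicShift_perm
      (factors (fun x => if b ≤ a then decide (x ≤ a) else decide (a < x)) w)
    rwa [factors_flatten] at this

theorem foata_perm (v : Word) : (foata v).Perm v := by
  induction v using List.reverseRecOn with
  | nil => simp [foata]
  | append_singleton v a ih =>
    rw [foata_append_singleton]
    exact (foataStep_perm _ _).trans (ih.append_right _)

theorem isBinary_foata {v : Word} : IsBinary (foata v) ↔ IsBinary v := by
  simp only [IsBinary, (foata_perm v).mem_iff]

theorem cyclicShift_append_singleton (u : Word) (c : ℕ+) : cyclicShift (u ++ [c]) = c :: u := by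
  rw [cyclicShift, List.length_append, List.length_singleton, Nat.add_sub_cancel,
    List.rotate_append_length_eq, List.singleton_append]

/-- Every factor has the form `u_j c` and becomes `c u_j`, so the product `c u_1 c u_2 ⋯ c u_k` is
the original word with its final `c` moved to the front. On binary words this makes a Foata step a
single rotation. -/
theorem shift_factors_of_unique {p : ℕ+ → Bool} {c : ℕ+} (hc : p c = true) (u : Word)
    (hu : ∀ x ∈ u, p x = true → x = c) :
    ((factors p (u ++ [c])).map cyclicShift).flatten = c :: u := by
  have h1 : ∀ a : ℕ+, cyclicShift [a] = [a] := cyclicShift_append_singleton []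
  induction u with
  | nil => simp [factors, hc, h1]
  | cons x u ih =>
    have ih := ih fun y hy => hu y (by simp [hy])
    rw [List.cons_append, factors]
    split_ifs with hx
    · have := hu x (by simp) hx
      subst this
      simp [ih, h1]
    · have hne : ∀ f ∈ factors p (u ++ [c]), f ≠ [] := by
        generalize u ++ [c] = w
        induction w with
        | nil => simp [factors]
        | cons y w ihw =>
          rw [factors]
          split_ifs
          · simpa using ihw
          · split <;> rename_i h <;> rw [h] at ihw <;> simp_all
      split
      · rename_i h
        have := factors_flatten p (u ++ [c])
        simp [h] at this
      · rename_i f fs h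
        rw [h] at ih hne
        have hf := hne f (by simp)
        obtain ⟨g, b, rfl⟩ := (List.eq_nil_or_concat f).resolve_left hf
        simp only [List.concat_eq_append, List.map_cons, cyclicShift_append_singleton,
          List.flatten_cons, List.cons_append, List.cons.injEq] at ih ⊢
        rw [← List.cons_append, cyclicShift_append_singleton]
        simp [ih.1, ih.2]

theorem shift_factors_of_all {p : ℕ+ → Bool} (u : Word) (hu : ∀ x ∈ u, p x = true) :
    ((factors p u).map cyclicShift).flatten = u := by
  have h1 : ∀ a : ℕ+, cyclicShift [a] = [a] := cyclicShift_append_singleton []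
  induction u with
  | nil => simp [factors]
  | cons x u ih =>
    rw [factors, if_pos (hu x (by simp))]
    simp [h1, ih fun y hy => hu y (by simp [hy])]

theorem foata_nil : foata [] = [] := rfl

theorem foata_one : foata [1] = [1] := rfl

theorem foata_append_two {v : Word} (hv : IsBinary v) : foata (v ++ [2]) = foata v ++ [2] := by
  have hv := isBinary_foata.2 hv
  rw [foata_append_singleton]
  generalize foata v = w at hv
  rw [foataStep]
  split
  · rename_i h
    simp_all
  · rename_i b h
    have hb : b ≤ 2 := by
      rcases hv b (List.mem_of_getLast? h) with rfl | rfl <;> decide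
    simp only [if_pos hb]
    rw [shift_factors_of_all]
    intro x hx
    rcases hv x hx with rfl | rfl <;> decide

theorem foataStep_one_of_one {u : Word} (hu : IsBinary u) :
    foataStep (u ++ [1]) 1 = 1 :: u ++ [1] := by
  rw [foataStep]
  simp only [List.getLast?_append, List.getLast?_singleton, Option.some_or]
  rw [shift_factors_of_unique (by simp)]
  intro x hx
  rcases hu x hx with rfl | rfl <;> decide

theorem foataStep_one_of_two {u : Word} (hu : IsBinary u) :
    foataStep (u ++ [2]) 1 = 2 :: u ++ [1] := by
  rw [foataStep]
  simp only [List.getLast?_append, List.getLast?_singleton, Option.some_or]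
  rw [shift_factors_of_unique (by decide)]
  intro x hx
  rcases hu x hx with rfl | rfl <;> decide

theorem foata_append_two_one {v : Word} (hv : IsBinary v) :
    foata (v ++ [2, 1]) = 2 :: foata v ++ [1] := by
  rw [show v ++ [2, 1] = (v ++ [2]) ++ [1] by simp, foata_append_singleton, foata_append_two hv,
    foataStep_one_of_two (isBinary_foata.2 hv)]

theorem exists_foata_append_singleton (v : Word) (a : ℕ+) : ∃ u, foata (v ++ [a]) = u ++ [a] := by
  rw [foata_append_singleton, foataStep]
  split
  · exact ⟨[], rfl⟩
  · exact ⟨_, rfl⟩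

theorem foata_append_one_one {v : Word} (hv : IsBinary v) :
    foata (v ++ [1, 1]) = 1 :: foata (v ++ [1]) := by
  obtain ⟨u, hu⟩ := exists_foata_append_singleton v 1
  have hb : IsBinary (u ++ [1]) := by
    rw [← hu, isBinary_foata]
    exact isBinary_append.2 ⟨hv, isBinary_one⟩
  rw [show v ++ [1, 1] = (v ++ [1]) ++ [1] by simp, foata_append_singleton, hu,
    foataStep_one_of_one (isBinary_append.1 hb).1, List.cons_append]

theorem count_foata (v : Word) (a : ℕ+) : (foata v).count a = v.count a := (foata_perm v).count_eq a

theorem length_foata (v : Word) : (foata v).length = v.length := (foata_perm v).length_eq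

theorem excess_foata (v : Word) : excess (foata v) = excess v := by
  rw [excess, excess, count_foata, count_foata]

/-- Foata's bijection turns the major index into the inversion number. -/
theorem inv_foata {v : Word} (hv : IsBinary v) : inv (foata v) = maj v := by
  induction v, hv using IsBinary.induction with
  | nil => simp [foata, inv, maj, desSet]
  | one => rw [foata_one]; simp [inv, maj, desSet]
  | two v hv ih =>
    rw [foata_append_two hv, inv_append_two (isBinary_foata.2 hv), ih, maj, maj,
      desSet_append_two hv]
  | one_one v hv ih =>
    rw [foata_append_one_one hv, inv_one_cons, ih, maj, maj, desSet_append_one_one]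
  | two_one v hv ih =>
    have hf := isBinary_foata.2 hv
    -- The new initial 2 forms an inversion with every 1, the new final 1 with every 2, and the two
    -- with each other: in all the length of `v` plus one, which is the position of the new descent.
    rw [foata_append_two_one hv, inv_append_one (by simp [isBinary_cons, hf]), inv_cons,
      countP_lt_two hf, ih, maj_append_two_one hv, length_eq_count_add_count hv,
      List.count_cons_self, count_foata, count_foata]
    omega

/-- The last letter, and if it is 1 also the first, tell which recursion to undo: strip a final 2,
an initial 1, or the outer pair `2 ⋯ 1`. -/
theorem exists_foata_eq {w : Word} (hw : IsBinary w) : ∃ v, IsBinary v ∧ foata v = w := by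
  suffices ∃ v, foata v = w by
    obtain ⟨v, rfl⟩ := this
    exact ⟨v, isBinary_foata.1 hw, rfl⟩
  induction h : w.length using Nat.strong_induction_on generalizing w with
  | _ n ih =>
    subst h
    rcases List.eq_nil_or_concat w with rfl | ⟨x, a, rfl⟩
    · exact ⟨[], rfl⟩
    simp only [List.concat_eq_append, isBinary_append, isBinary_cons] at hw ⊢
    obtain ⟨hx, ha, -⟩ := hw
    rcases ha with rfl | rfl
    · rcases x with _ | ⟨b, x⟩
      · exact ⟨[1], rfl⟩
      · rw [isBinary_cons] at hx
        rcases hx.1 with rfl | rfl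
        · obtain ⟨v, hv⟩ := ih (x ++ [1]).length (by simp)
            (isBinary_append.2 ⟨hx.2, isBinary_one⟩) rfl
          rcases List.eq_nil_or_concat v with rfl | ⟨y, c, rfl⟩
          · simp [foata] at hv
          obtain ⟨u, hu⟩ := exists_foata_append_singleton y c
          rw [List.concat_eq_append] at hv
          have hc : c = 1 := by
            rw [hu] at hv
            exact (List.append_inj' hv rfl).2 |> List.singleton_inj.1
          subst hc
          have hy : IsBinary (y ++ [1]) := by
            rw [← isBinary_foata, hv]
            exact isBinary_append.2 ⟨hx.2, isBinary_one⟩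
          exact ⟨y ++ [1, 1], by rw [foata_append_one_one (isBinary_append.1 hy).1, hv]; rfl⟩
        · obtain ⟨v, rfl⟩ := ih x.length (by simp) hx.2 rfl
          exact ⟨v ++ [2, 1], foata_append_two_one (isBinary_foata.1 hx.2)⟩
    · obtain ⟨v, rfl⟩ := ih x.length (by simp) hx rfl
      exact ⟨v ++ [2], foata_append_two (isBinary_foata.1 hx)⟩

/-- Foata's map keeps the last letter, and among words of length at least two ending in 1 the first
letter of the image separates `v11` from `v21`. Binarity of the second word is inherited, because
the images are rearrangements. -/
theorem foata_injOn {v v' : Word} (hv : IsBinary v) (h : foata v = foata v') : v = v' := by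
  have hv' : IsBinary v' := by rw [← isBinary_foata, ← h, isBinary_foata]; exact hv
  have hlast : ∀ (x y : Word) (a b : ℕ+), foata (x ++ [a]) = foata (y ++ [b]) → a = b := by
    intro x y a b h
    obtain ⟨u, hu⟩ := exists_foata_append_singleton x a
    obtain ⟨u', hu'⟩ := exists_foata_append_singleton y b
    rw [hu, hu'] at h
    exact (List.append_inj' h rfl).2 |> List.singleton_inj.1
  have hlen : v.length = v'.length := by rw [← length_foata v, h, length_foata]
  induction v, hv using IsBinary.induction generalizing v' with
  | nil => exact (List.eq_nil_of_length_eq_zero hlen.symm).symm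
  | one =>
    obtain ⟨c, rfl⟩ := List.length_eq_one_iff.1 hlen.symm
    rw [hlast [] [] 1 c h]
  | two v hv ih =>
    rcases List.eq_nil_or_concat v' with rfl | ⟨y, c, rfl⟩
    · simp at hlen
    rw [List.concat_eq_append] at h hv' hlen ⊢
    obtain rfl := hlast _ _ _ _ h
    have hy := (isBinary_append.1 hv').1
    rw [foata_append_two hv, foata_append_two hy] at h
    rw [ih (List.append_cancel_right h) hy (by simpa using hlen)]
  | one_one v hv ih =>
    rcases List.eq_nil_or_concat v' with rfl | ⟨x, c, rfl⟩
    · simp at hlen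
    rw [List.concat_eq_append] at h hv' hlen ⊢
    obtain rfl := hlast (v ++ [1]) _ _ _ (by simpa using h)
    have hx := (isBinary_append.1 hv').1
    rcases List.eq_nil_or_concat x with rfl | ⟨y, c, rfl⟩
    · simp at hlen
    simp only [List.concat_eq_append, List.append_assoc, List.singleton_append] at h hx hlen ⊢
    have hy := (isBinary_append.1 hx).1
    rcases (isBinary_cons.1 (isBinary_append.1 hx).2).1 with rfl | rfl
    · rw [foata_append_one_one hv, foata_append_one_one hy] at h
      have := ih (List.cons_injective h) hx (by simpa using hlen)
      rw [List.append_cancel_right this]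
    · rw [foata_append_one_one hv, foata_append_two_one hy] at h
      have := (List.cons.inj h).1
      exact absurd this (by decide)
  | two_one v hv ih =>
    rcases List.eq_nil_or_concat v' with rfl | ⟨x, c, rfl⟩
    · simp at hlen
    rw [List.concat_eq_append] at h hv' hlen ⊢
    obtain rfl := hlast (v ++ [2]) _ _ _ (by simpa using h)
    have hx := (isBinary_append.1 hv').1
    rcases List.eq_nil_or_concat x with rfl | ⟨y, c, rfl⟩
    · simp at hlen
    simp only [List.concat_eq_append, List.append_assoc, List.singleton_append] at h hx hlen ⊢
    have hy := (isBinary_append.1 hx).1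
    rcases (isBinary_cons.1 (isBinary_append.1 hx).2).1 with rfl | rfl
    · rw [foata_append_two_one hv, foata_append_one_one hy] at h
      have := (List.cons.inj h).1
      exact absurd this (by decide)
    · rw [foata_append_two_one hv, foata_append_two_one hy] at h
      have := List.append_cancel_right h
      rw [ih (List.cons_injective this) hy (by simpa using hlen)]

/-! ### The partition with a given boundary word -/

/-- The row lengths of the partition bounded by the lattice path of the reversed word. -/
def rowsRev : Word → List ℕ
  | [] => []
  | a :: s => if a = 1 then s.count 2 :: rowsRev s else rowsRev s

/-- The row lengths, possibly zero, of the partition bounded by the lattice path of a word. -/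
def rows (w : Word) : List ℕ := rowsRev w.reverse

theorem rows_nil : rows [] = [] := rfl

theorem rows_append_one (w : Word) : rows (w ++ [1]) = w.count 2 :: rows w := by
  simp [rows, rowsRev]

theorem rows_append_of_ne (w : Word) {a : ℕ+} (ha : a ≠ 1) : rows (w ++ [a]) = rows w := by
  simp [rows, rowsRev, ha]

theorem rows_append_two (w : Word) : rows (w ++ [2]) = rows w :=
  rows_append_of_ne w (by decide)

theorem rows_append_replicate_two (w : Word) (n : ℕ) :
    rows (w ++ List.replicate n 2) = rows w := by
  induction n with
  | zero => simp
  | succ n ih => rw [List.replicate_succ', ← List.append_assoc, rows_append_two, ih]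

theorem length_rows (w : Word) : (rows w).length = w.count 1 := by
  induction w using List.reverseRecOn with
  | nil => simp [rows_nil]
  | append_singleton w a ih =>
    by_cases ha : a = 1
    · subst ha
      rw [rows_append_one]
      simp [ih]
    · rw [rows_append_of_ne w ha, ih]
      simp [ha]

theorem le_count_of_mem_rows {w : Word} {x : ℕ} (hx : x ∈ rows w) : x ≤ w.count 2 := by
  induction w using List.reverseRecOn with
  | nil => simp [rows_nil] at hx
  | append_singleton w a ih =>
    have hc : w.count 2 ≤ (w ++ [a]).count 2 := by simp
    by_cases ha : a = 1
    · subst ha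
      rw [rows_append_one, List.mem_cons] at hx
      rcases hx with rfl | hx
      · exact hc
      · exact (ih hx).trans hc
    · rw [rows_append_of_ne w ha] at hx
      exact (ih hx).trans hc

theorem rows_sortedGE (w : Word) : (rows w).SortedGE := by
  rw [List.sortedGE_iff_pairwise]
  induction w using List.reverseRecOn with
  | nil => simp [rows_nil]
  | append_singleton w a ih =>
    by_cases ha : a = 1
    · subst ha
      rw [rows_append_one, List.pairwise_cons]
      exact ⟨fun x hx => le_count_of_mem_rows hx, ih⟩
    · rwa [rows_append_of_ne w ha]

/-- An initial north step is a row of length 0. Such rows are kept in the list, so that its length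
counts the ones; they become rows of length 1 once a 2 is put in front. -/
theorem rows_one_cons (w : Word) : rows (1 :: w) = rows w ++ [0] := by
  induction w using List.reverseRecOn with
  | nil => rfl
  | append_singleton w a ih =>
    rw [← List.cons_append]
    by_cases ha : a = 1
    · subst ha
      rw [rows_append_one, rows_append_one, ih, List.count_cons_of_ne (by decide)]
      simp
    · rw [rows_append_of_ne _ ha, rows_append_of_ne _ ha, ih]

theorem rows_two_cons (w : Word) : rows (2 :: w) = (rows w).map (· + 1) := by
  induction w using List.reverseRecOn with
  | nil => rfl
  | append_singleton w a ih =>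
    rw [← List.cons_append]
    by_cases ha : a = 1
    · subst ha
      rw [rows_append_one, rows_append_one, ih]
      simp
    · rw [rows_append_of_ne _ ha, rows_append_of_ne _ ha, ih]

/-- The partition bounded by the lattice path of a word. -/
def diagram (w : Word) : YoungDiagram := YoungDiagram.ofRowLens (rows w) (rows_sortedGE w)

theorem mem_diagram {w : Word} {i j : ℕ} : (i, j) ∈ diagram w ↔ j < (rows w).getD i 0 := by
  rw [diagram, YoungDiagram.mem_ofRowLens]
  simp only [List.getD_eq_getElem?_getD]
  constructor
  · rintro ⟨h, h'⟩
    simpa [h] using h'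
  · intro h
    by_cases hi : i < (rows w).length
    · exact ⟨hi, by simpa [hi] using h⟩
    · simp [hi] at h

theorem rowLen_diagram (w : Word) (i : ℕ) : (diagram w).rowLen i = (rows w).getD i 0 := by
  refine eq_of_forall_lt_iff fun j => ?_
  rw [← YoungDiagram.mem_iff_lt_rowLen, mem_diagram]

theorem card_cellsOfRowLens (L : List ℕ) : (YoungDiagram.cellsOfRowLens L).card = L.sum := by
  induction L with
  | nil => rfl
  | cons x L ih =>
    rw [YoungDiagram.cellsOfRowLens, Finset.card_union_of_disjoint]
    · simp [ih]
    · rw [Finset.disjoint_left]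
      rintro ⟨i, j⟩ h h'
      simp only [Finset.mem_product, Finset.mem_singleton] at h
      simp [h.1] at h'

theorem card_diagram {w : Word} (hw : IsBinary w) : (diagram w).card = inv w := by
  refine (card_cellsOfRowLens (rows w)).trans ?_
  induction w using List.reverseRecOn with
  | nil => simp [rows_nil, inv]
  | append_singleton w a ih =>
    rw [isBinary_append, isBinary_cons] at hw
    rcases hw.2.1 with rfl | rfl
    · rw [rows_append_one, inv_append_one hw.1, List.sum_cons, ih hw.1, add_comm]
    · rw [rows_append_two, inv_append_two hw.1, ih hw.1]

theorem diagram_append_two (w : Word) : diagram (w ++ [2]) = diagram w := by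
  simp only [diagram, rows_append_two]

theorem diagram_one_cons (w : Word) : diagram (1 :: w) = diagram w := by
  ext ⟨i, j⟩
  rw [YoungDiagram.mem_cells, YoungDiagram.mem_cells, mem_diagram, mem_diagram, rows_one_cons]
  rcases lt_trichotomy i (rows w).length with h | h | h
  · rw [List.getD_append _ _ _ _ h]
  · subst h; simp [List.getD_eq_getElem?_getD]
  · rw [List.getD_eq_default _ _ (by simp; omega), List.getD_eq_default _ _ h.le]

theorem mem_diagram_two_append_one_zero {u : Word} {j : ℕ} :
    (0, j) ∈ diagram (2 :: u ++ [1]) ↔ j < u.count 2 + 1 := by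
  rw [mem_diagram, rows_append_one]
  simp

theorem mem_diagram_two_append_one_succ {u : Word} {i j : ℕ} :
    (i + 1, j) ∈ diagram (2 :: u ++ [1]) ↔ i < u.count 1 ∧ j < (rows u).getD i 0 + 1 := by
  rw [mem_diagram, rows_append_one, rows_two_cons, ← length_rows]
  simp only [List.getD_eq_getElem?_getD, List.getElem?_cons_succ, List.getElem?_map]
  by_cases h : i < (rows u).length
  · simp [h]
  · simp [h]

theorem rowLen_zero_hook (u : Word) : (diagram (2 :: u ++ [1])).rowLen 0 = u.count 2 + 1 :=
  eq_of_forall_lt_iff fun j => by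
    rw [← YoungDiagram.mem_iff_lt_rowLen, mem_diagram_two_append_one_zero]

theorem rowLen_succ_hook {u : Word} {i : ℕ} (hi : i < u.count 1) :
    (diagram (2 :: u ++ [1])).rowLen (i + 1) = (diagram u).rowLen i + 1 :=
  eq_of_forall_lt_iff fun j => by
    rw [← YoungDiagram.mem_iff_lt_rowLen, mem_diagram_two_append_one_succ, rowLen_diagram]
    simp [hi]

theorem colLen_zero_hook (u : Word) : (diagram (2 :: u ++ [1])).colLen 0 = u.count 1 + 1 :=
  eq_of_forall_lt_iff fun i => by
    rw [← YoungDiagram.mem_iff_lt_colLen]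
    cases i with
    | zero => simp only [mem_diagram_two_append_one_zero]; simp
    | succ i => simp only [mem_diagram_two_append_one_succ]; simp

theorem lt_count_of_mem_diagram {u : Word} {i j : ℕ} (h : (i, j) ∈ diagram u) :
    i < u.count 1 ∧ j < u.count 2 := by
  rw [mem_diagram, List.getD_eq_getElem?_getD] at h
  rw [← length_rows]
  by_cases hi : i < (rows u).length
  · simp only [hi, List.getElem?_eq_getElem, Option.getD_some] at h
    exact ⟨hi, h.trans_le (le_count_of_mem_rows (List.getElem_mem hi))⟩
  · simp [hi] at h

/-- The initial 2 adds a column on the left and the final 1 a row on top; deleting both recovers the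
diagram of `u`. -/
theorem mem_hook_succ_succ {u : Word} {i j : ℕ} :
    (i + 1, j + 1) ∈ diagram (2 :: u ++ [1]) ↔ (i, j) ∈ diagram u := by
  rw [mem_diagram_two_append_one_succ, add_lt_add_iff_right, ← mem_diagram]
  exact ⟨fun h => h.2, fun h => ⟨(lt_count_of_mem_diagram h).1, h⟩⟩

theorem colLen_succ_hook {u : Word} {j : ℕ} (hj : j < u.count 2) :
    (diagram (2 :: u ++ [1])).colLen (j + 1) = (diagram u).colLen j + 1 :=
  eq_of_forall_lt_iff fun i => by
    rw [← YoungDiagram.mem_iff_lt_colLen]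
    cases i with
    | zero => simp only [mem_diagram_two_append_one_zero]; simp [hj]
    | succ i => rw [mem_hook_succ_succ, YoungDiagram.mem_iff_lt_colLen]; simp

/-! ### Durfee squares and ranks -/

/-- A diagram is closed towards the upper left, so a square lies in it as soon as its diagonal does.
-/
theorem lt_durfee_iff {l : YoungDiagram} {i : ℕ} : i < durfee l ↔ (i, i) ∈ l := by
  have hsub : ∀ d, (Finset.range d ×ˢ Finset.range d ⊆ l.cells) ↔ ∀ k < d, (k, k) ∈ l := by
    intro d
    constructor
    · intro h k hk
      exact h (by simp [hk])
    · rintro h ⟨a, b⟩ hab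
      simp only [Finset.mem_product, Finset.mem_range] at hab
      exact l.up_left_mem (le_max_left a b) (le_max_right a b) (h _ (max_lt hab.1 hab.2))
  constructor
  · intro h
    have := Nat.findGreatest_spec (P := fun d => Finset.range d ×ˢ Finset.range d ⊆ l.cells)
      (n := l.colLen 0) (m := 0) (Nat.zero_le _) (by simp)
    exact (hsub _).1 this i h
  · intro h
    refine Nat.le_findGreatest ?_ ((hsub _).2 fun k hk =>
      l.up_left_mem (Nat.lt_succ_iff.1 hk) (Nat.lt_succ_iff.1 hk) h)
    exact YoungDiagram.mem_iff_lt_colLen.1 (l.up_left_mem le_rfl (Nat.zero_le _) h)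

theorem durfee_transpose (l : YoungDiagram) : durfee l.transpose = durfee l :=
  eq_of_forall_lt_iff fun i => by
    rw [lt_durfee_iff, lt_durfee_iff, YoungDiagram.mem_transpose, Prod.swap_prod_mk]

theorem rank_transpose (l : YoungDiagram) (i : ℕ) : rank l.transpose i = -rank l i := by
  rw [rank, rank, YoungDiagram.rowLen_transpose, YoungDiagram.colLen_transpose]
  ring

theorem durfee_hook (u : Word) : durfee (diagram (2 :: u ++ [1])) = durfee (diagram u) + 1 :=
  eq_of_forall_lt_iff fun i => by
    rw [lt_durfee_iff]
    cases i with
    | zero => rw [mem_diagram_two_append_one_zero]; simp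
    | succ i => rw [mem_hook_succ_succ, ← lt_durfee_iff, add_lt_add_iff_right]

theorem rank_zero_hook (u : Word) : rank (diagram (2 :: u ++ [1])) 0 = excess u := by
  rw [rank, rowLen_zero_hook, colLen_zero_hook, excess]
  push_cast
  ring

theorem rank_succ_hook {u : Word} {i : ℕ} (hi : i < durfee (diagram u)) :
    rank (diagram (2 :: u ++ [1])) (i + 1) = rank (diagram u) i := by
  have := lt_count_of_mem_diagram (lt_durfee_iff.1 hi)
  rw [rank, rowLen_succ_hook this.1, colLen_succ_hook this.2, rank]
  push_cast
  ring

theorem diagram_nil : diagram [] = ⊥ := by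
  ext ⟨i, j⟩
  rw [YoungDiagram.mem_cells, mem_diagram]
  simp [rows_nil]

theorem diagram_one : diagram [1] = ⊥ := by rw [diagram_one_cons, diagram_nil]

theorem durfee_bot : durfee ⊥ = 0 :=
  eq_of_forall_lt_iff fun i => by rw [lt_durfee_iff]; simp

theorem durfee_diagram_foata {v : Word} (hv : IsBinary v) :
    durfee (diagram (foata v)) = des v := by
  induction v, hv using IsBinary.induction with
  | nil => rw [foata_nil, diagram_nil, durfee_bot, des, desSet_nil, Finset.card_empty]
  | one => rw [foata_one, diagram_one, durfee_bot, des, desSet_singleton, Finset.card_empty]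
  | two v hv ih =>
    rw [foata_append_two hv, diagram_append_two, ih, des, des, desSet_append_two hv]
  | one_one v hv ih =>
    rw [foata_append_one_one hv, diagram_one_cons, ih, des, des, desSet_append_one_one]
  | two_one v hv ih => rw [foata_append_two_one hv, durfee_hook, ih, des_append_two_one hv]

/-! ### Excesses at descents and ranks -/

theorem image_excess_congr {v v' : Word} (h : v <+: v') :
    (desSet v).image (fun k => excess (v'.take k)) =
      (desSet v).image fun k => excess (v.take k) := by
  obtain ⟨s, rfl⟩ := h
  refine Finset.image_congr fun k hk => ?_
  rw [List.take_append_of_le_length (lt_length_of_mem_desSet hk).le]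

theorem excess_append (u v : Word) : excess (u ++ v) = excess u + excess v := by
  simp only [excess, List.count_append]
  push_cast
  ring

theorem excess_two : excess [2] = 1 := by decide
theorem excess_one : excess [1] = -1 := by decide
theorem excess_nil : excess [] = 0 := by decide

theorem image_range_succ {α : Type*} [DecidableEq α] (f : ℕ → α) (n : ℕ) :
    (Finset.range (n + 1)).image f = insert (f 0) ((Finset.range n).image fun i => f (i + 1)) := by
  rw [Finset.range_add_one', Finset.image_insert, Finset.map_eq_image, Finset.image_image]
  rfl

/-- The excesses of a binary word at its descents are the ranks of its Foata image, plus one. -/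
theorem image_excess_desSet {v : Word} (hv : IsBinary v) :
    (desSet v).image (fun k => excess (v.take k)) =
      (Finset.range (durfee (diagram (foata v)))).image
        fun i => rank (diagram (foata v)) i + 1 := by
  induction v, hv using IsBinary.induction with
  | nil => rw [foata_nil, diagram_nil, durfee_bot, desSet_nil]; rfl
  | one => rw [foata_one, diagram_one, durfee_bot, desSet_singleton]; rfl
  | two v hv ih =>
    rw [foata_append_two hv, diagram_append_two, ← ih, desSet_append_two hv,
      image_excess_congr (List.prefix_append v [2])]
  | one_one v hv ih =>
    rw [foata_append_one_one hv, diagram_one_cons, ← ih, desSet_append_one_one,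
      image_excess_congr (v' := v ++ [1, 1]) ⟨[1], by simp⟩]
  | two_one v hv ih =>
    rw [foata_append_two_one hv, durfee_hook, desSet_append_two_one hv, Finset.image_insert,
      image_excess_congr (List.prefix_append v [2, 1]), ih, image_range_succ, rank_zero_hook,
      excess_foata]
    congr 1
    -- The prefix at the new descent is `v2`; its last letter accounts for the shift by one between
    -- excess and rank.
    · rw [show v ++ [2, 1] = (v ++ [2]) ++ [1] by simp, List.take_left' (by simp), excess_append,
        excess_two]
    · refine Finset.image_congr fun i hi => ?_
      rw [rank_succ_hook (by simpa using hi)]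

theorem sup'_eq_of_image_eq {s t : Finset ℕ} (hs : s.Nonempty) (ht : t.Nonempty) {f g : ℕ → ℤ}
    (h : s.image f = t.image g) : s.sup' hs f = t.sup' ht g := by
  have hs' : s.sup' hs f = (s.image f).sup' (hs.image f) id := by
    rw [Finset.sup'_image]; rfl
  have ht' : t.sup' ht g = (t.image g).sup' (ht.image g) id := by
    rw [Finset.sup'_image]; rfl
  rw [hs', ht']
  congr 1

theorem e_nil : e [] = 0 := by simp [e, desSet_nil, excess]

theorem maxRank_bot : maxRank ⊥ = -1 := by
  rw [maxRank, dif_neg]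
  simp [durfee_bot]

/-- The statistic `e` is the maximum rank of the Foata image, plus one. -/
theorem e_append_two_one {v : Word} (hv : IsBinary v) :
    e (v ++ [2, 1]) = maxRank (diagram (foata (v ++ [2, 1]))) + 1 := by
  set w := v ++ [2, 1] with hw
  have hwb : IsBinary w := isBinary_append.2 ⟨hv, isBinary_two_one⟩
  have hmem : v.length + 1 ∈ desSet w := by rw [hw, desSet_append_two_one hv]; simp
  have hne : (desSet w).Nonempty := ⟨_, hmem⟩
  -- The final 1 lowers the excess, so the whole word never beats the prefix at the last descent and
  -- can be dropped from the maximum.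
  have hlast : excess (w.take w.length) ≤ excess (w.take (v.length + 1)) := by
    rw [List.take_length, hw, show v ++ [2, 1] = (v ++ [2]) ++ [1] by simp,
      List.take_left' (by simp), excess_append (v ++ [2]), excess_one]
    omega
  have h1 : e w = (desSet w).sup' hne fun k => excess (w.take k) := by
    rw [e, Finset.sup'_insert (H := hne)]
    exact sup_eq_right.2 (hlast.trans (Finset.le_sup' (fun k => excess (w.take k)) hmem))
  have hd : (Finset.range (durfee (diagram (foata w)))).Nonempty := by
    rw [durfee_diagram_foata hwb, Finset.nonempty_range_iff, des]
    exact (Finset.card_pos.2 hne).ne'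
  rw [h1, maxRank, dif_pos hd, sup'_eq_of_image_eq hne hd (image_excess_desSet hwb)]
  exact (Finset.apply_sup'_eq_sup'_comp hd (fun x : ℤ => x + 1)
    (fun x y => max_add_add_right x y 1 |>.symm)).symm

/-! ### Boundary words -/

/-- The boundary word of a partition with `k` rows of lengths `r 0, r 1, …`. -/
theorem flatMap_rows (k : ℕ) (r : ℕ → ℕ) (hr : Antitone r) (hk : r k = 0) :
    let w : Word := (List.range k).reverse.flatMap fun i =>
      List.replicate (r i - r (i + 1)) (2 : ℕ+) ++ [(1 : ℕ+)]
    w.count 2 = r 0 ∧ ∀ i, (rows w).getD i 0 = r i := by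
  induction k generalizing r with
  | zero =>
    simp only [List.range_zero, List.reverse_nil, List.flatMap_nil, List.count_nil]
    refine ⟨hk.symm, fun i => ?_⟩
    have := hr (Nat.zero_le i)
    simp [rows_nil]
    omega
  | succ k ih =>
    have ih := ih (fun i => r (i + 1)) (fun a b h => hr (Nat.succ_le_succ h)) hk
    simp only at ih ⊢
    rw [List.range_succ_eq_map, List.reverse_cons, List.flatMap_append, ← List.map_reverse,
      List.flatMap_map, List.flatMap_singleton]
    set w : Word := (List.range k).reverse.flatMap fun i =>
      List.replicate (r (i + 1) - r (i + 1 + 1)) (2 : ℕ+) ++ [(1 : ℕ+)] with hw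
    change (w ++ (List.replicate (r 0 - r (0 + 1)) 2 ++ [1])).count 2 = r 0 ∧ ∀ i,
      (rows (w ++ (List.replicate (r 0 - r (0 + 1)) 2 ++ [1]))).getD i 0 = r i
    have h01 : r 1 ≤ r 0 := hr (Nat.zero_le 1)
    have hc : (w ++ List.replicate (r 0 - r (0 + 1)) (2 : ℕ+)).count 2 = r 0 := by
      rw [List.count_append, ih.1, List.count_replicate_self]
      simp only [zero_add]
      omega
    rw [← List.append_assoc]
    refine ⟨by rw [List.count_append, hc]; rfl, fun i => ?_⟩
    rw [rows_append_one, hc, rows_append_replicate_two]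
    cases i with
    | zero => simp
    | succ i => rw [List.getD_cons_succ]; exact ih.2 i

theorem rowLen_colLen_zero (l : YoungDiagram) : l.rowLen (l.colLen 0) = 0 := by
  by_contra h
  have := YoungDiagram.mem_iff_lt_rowLen.2 (Nat.pos_of_ne_zero h)
  rw [YoungDiagram.mem_iff_lt_colLen] at this
  exact lt_irrefl _ this

theorem diagram_boundaryWord (l : YoungDiagram) : diagram (boundaryWord l) = l := by
  have := flatMap_rows (l.colLen 0) l.rowLen (fun a b h => l.rowLen_anti a b h)
    (rowLen_colLen_zero l)
  ext ⟨i, j⟩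
  rw [YoungDiagram.mem_cells, YoungDiagram.mem_cells, mem_diagram, boundaryWord, this.2,
    YoungDiagram.mem_iff_lt_rowLen]

theorem boundaryWord_bot : boundaryWord ⊥ = [] := by
  have : (⊥ : YoungDiagram).colLen 0 = 0 :=
    eq_of_forall_lt_iff fun i => by rw [← YoungDiagram.mem_iff_lt_colLen]; simp
  simp [boundaryWord, this]

/-- A binary word is determined by its rows and its number of twos. -/
theorem eq_of_rows_eq {u u' : Word} (hu : IsBinary u) (hu' : IsBinary u')
    (h1 : u.count 2 = u'.count 2) (h : rows u = rows u') : u = u' := by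
  have hlen : u.length = u'.length := by
    rw [length_eq_count_add_count hu, length_eq_count_add_count hu', h1, ← length_rows,
      ← length_rows, h]
  induction u using List.reverseRecOn generalizing u' with
  | nil => exact (List.eq_nil_of_length_eq_zero hlen.symm).symm
  | append_singleton u a ih =>
    rcases List.eq_nil_or_concat u' with rfl | ⟨y, c, rfl⟩
    · simp at hlen
    simp only [List.concat_eq_append, isBinary_append, isBinary_cons] at *
    have hne : (1 : ℕ+) ≠ 2 := by decide
    obtain ⟨hu, ha, -⟩ := hu
    obtain ⟨hy, hc, -⟩ := hu'
    have hlen' : u.length = y.length := by simpa using hlen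
    rcases ha with rfl | rfl <;> rcases hc with rfl | rfl
    · rw [rows_append_one, rows_append_one, List.cons.injEq] at h
      rw [ih hu hy h.1 h.2 hlen']
    · rw [rows_append_one, rows_append_two] at h
      -- If only one word ends in 1, its top row has as many cells as it has twos, but the other
      -- word offers one two fewer before its final 2.
      have := le_count_of_mem_rows (w := y) (h ▸ List.mem_cons_self)
      simp at h1
      omega
    · rw [rows_append_one, rows_append_two] at h
      have := le_count_of_mem_rows (w := u) (h ▸ List.mem_cons_self)
      simp at h1
      omega
    · rw [rows_append_two, rows_append_two] at h
      rw [ih hu hy (by simpa using h1) h hlen']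

theorem isBinary_boundaryWord (l : YoungDiagram) : IsBinary (boundaryWord l) := by
  intro a ha
  simp only [boundaryWord, List.mem_flatMap, List.mem_append, List.mem_singleton] at ha
  obtain ⟨i, -, h | h⟩ := ha
  · exact .inr (List.eq_of_mem_replicate h)
  · exact .inl h

/-- The lowest row is nonempty, which forces an east step at the start; the path ends with the north
step of the top row. -/
theorem boundaryWord_eq_or (l : YoungDiagram) :
    boundaryWord l = [] ∨ ∃ u, IsBinary u ∧ boundaryWord l = 2 :: u ++ [1] := by
  have hb := isBinary_boundaryWord l
  obtain hn | ⟨n, hn⟩ : l.colLen 0 = 0 ∨ ∃ n, l.colLen 0 = n + 1 := by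
    cases l.colLen 0 <;> simp
  · exact .inl (by simp [boundaryWord, hn])
  right
  have hstart : ∃ x, boundaryWord l = 2 :: x := by
    rw [boundaryWord, hn, List.range_succ, List.reverse_append]
    have : 0 < l.rowLen n - l.rowLen (n + 1) := by
      rw [← hn, rowLen_colLen_zero, Nat.sub_zero, ← YoungDiagram.mem_iff_lt_rowLen,
        YoungDiagram.mem_iff_lt_colLen]
      omega
    obtain ⟨m, hm⟩ := Nat.exists_eq_add_one_of_ne_zero this.ne'
    simp [hm, List.replicate_succ]
  have hend : ∃ x, boundaryWord l = x ++ [1] := by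
    rw [boundaryWord, hn, List.range_succ_eq_map, List.reverse_cons, List.flatMap_append,
      List.flatMap_singleton, ← List.append_assoc]
    exact ⟨_, rfl⟩
  obtain ⟨x, hx⟩ := hstart
  rcases List.eq_nil_or_concat x with rfl | ⟨u, a, rfl⟩
  · obtain ⟨y, hy⟩ := hend
    rw [hy] at hx
    rcases List.eq_nil_or_concat y with rfl | ⟨z, c, rfl⟩
    · have := List.cons.inj hx
      exact absurd this.1 (by decide)
    · simpa using congrArg List.length hx
  · obtain ⟨y, hy⟩ := hend
    rw [List.concat_eq_append, ← List.cons_append] at hx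
    have : a = 1 := by
      rw [hy] at hx
      exact ((List.append_inj' hx rfl).2 |> List.singleton_inj.1).symm
    subst this
    rw [hx, isBinary_append, isBinary_cons] at hb
    exact ⟨u, hb.1.2, hx⟩

/-- Since no row is zero, the diagram determines the list of rows, and the final 1 makes the top row
count the twos. These data determine a binary word. -/
theorem boundaryWord_diagram_hook {u : Word} (hu : IsBinary u) :
    boundaryWord (diagram (2 :: u ++ [1])) = 2 :: u ++ [1] := by
  set l := diagram (2 :: u ++ [1]) with hl
  have hpos : ∀ x : Word, ∀ y ∈ rows (2 :: x ++ [1]), 0 < y := by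
    intro x y hy
    rw [rows_append_one, rows_two_cons] at hy
    simp only [List.count_cons_self, List.mem_cons, List.mem_map] at hy
    rcases hy with rfl | ⟨z, -, rfl⟩ <;> omega
  have hrows : ∀ x : Word, (diagram (2 :: x ++ [1])).rowLens = rows (2 :: x ++ [1]) := fun x =>
    YoungDiagram.rowLens_ofRowLens_eq_self (hpos x)
  rcases boundaryWord_eq_or l with h | ⟨x, hx, h⟩
  · have : l = ⊥ := by rw [← diagram_boundaryWord l, h, diagram_nil]
    have h0 : (0, 0) ∈ l := by rw [hl, mem_diagram_two_append_one_zero]; omega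
    rw [this] at h0
    simp at h0
  · have hd : diagram (2 :: x ++ [1]) = diagram (2 :: u ++ [1]) := by
      rw [← h, diagram_boundaryWord]
    have hr : rows (2 :: x ++ [1]) = rows (2 :: u ++ [1]) := by rw [← hrows, ← hrows, hd]
    have hc := hr
    rw [rows_append_one, rows_append_one, List.cons.injEq] at hc
    rw [h]
    refine eq_of_rows_eq ?_ ?_ ?_ hr
    · simp [isBinary_append, isBinary_cons, hx, isBinary_nil]
    · simp [isBinary_append, isBinary_cons, hu, isBinary_nil]
    · rw [List.count_append, hc.1, List.count_append]

/-! ### Preimages under Foata's bijection -/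

theorem nil_mem_W (v : Word) : [] ∈ W v := .inr rfl

theorem append_two_one_mem_W {u : Word} (hu : IsBinary u) : u ++ [2, 1] ∈ W [2, 1] :=
  .inl ⟨u, hu, rfl⟩

theorem mem_W_cases {v w : Word} (h : w ∈ W v) : w = [] ∨ ∃ u, IsBinary u ∧ w = u ++ v := by
  rcases h with h | h
  · exact .inr h
  · exact .inl h

theorem isBinary_of_mem_W {w : Word} (h : w ∈ W [2, 1]) : IsBinary w := by
  rcases mem_W_cases h with rfl | ⟨u, hu, rfl⟩
  · exact isBinary_nil
  · exact isBinary_append.2 ⟨hu, isBinary_two_one⟩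

theorem boundaryWord_diagram_foata {v : Word} (hv : v ∈ W [2, 1]) :
    boundaryWord (diagram (foata v)) = foata v := by
  rcases mem_W_cases hv with rfl | ⟨u, hu, rfl⟩
  · rw [foata_nil, diagram_nil, boundaryWord_bot]
  · rw [foata_append_two_one hu, boundaryWord_diagram_hook (isBinary_foata.2 hu)]

theorem exists_mem_W_foata_eq (l : YoungDiagram) : ∃ v ∈ W [2, 1], foata v = boundaryWord l := by
  rcases boundaryWord_eq_or l with h | ⟨u, hu, h⟩
  · exact ⟨[], nil_mem_W _, by rw [h, foata_nil]⟩
  · obtain ⟨x, hx, rfl⟩ := exists_foata_eq hu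
    exact ⟨x ++ [2, 1], append_two_one_mem_W hx, by rw [h, foata_append_two_one hx]⟩

theorem mem_preimage_foata_iff {T : Set YoungDiagram} {v : Word} :
    v ∈ foata ⁻¹' (boundaryWord '' T) ↔ v ∈ W [2, 1] ∧ diagram (foata v) ∈ T := by
  constructor
  · rintro ⟨l, hl, h⟩
    -- The word `v` is not yet known to be binary; a preimage inside `W_21` is, and injectivity
    -- identifies the two.
    obtain ⟨x, hx, hxl⟩ := exists_mem_W_foata_eq l
    obtain rfl := foata_injOn (isBinary_of_mem_W hx) (hxl.trans h)
    rw [← h, diagram_boundaryWord]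
    exact ⟨hx, hl⟩
  · rintro ⟨hv, hT⟩
    exact ⟨_, hT, boundaryWord_diagram_foata hv⟩

theorem mem_conj {L : Set YoungDiagram} {l : YoungDiagram} : l ∈ conj L ↔ l.transpose ∈ L := by
  constructor
  · rintro ⟨m, hm, rfl⟩
    rwa [YoungDiagram.transpose_transpose]
  · intro h
    exact ⟨_, h, YoungDiagram.transpose_transpose l⟩

theorem isBallot_iff {v : Word} (hv : IsBinary v) :
    IsBallot v ↔ ∀ p, p <+: v → excess p ≤ 0 := by
  refine forall₂_congr fun p hp => ?_
  constructor
  · intro h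
    have : p.count 2 ≤ p.count 1 := h 1
    rw [excess]
    omega
  · intro h i
    by_cases hi : i = 1
    · subst hi
      rw [excess] at h
      change p.count 2 ≤ p.count 1
      omega
    · rw [List.count_eq_zero_of_not_mem]
      · exact Nat.zero_le _
      · intro hmem
        rcases hv _ (hp.subset hmem) with h' | h'
        · exact absurd h' (PNat.lt_add_left 1 i).ne'
        · exact hi (add_right_cancel (b := (1 : ℕ+)) h')

/-- The excess of a prefix is bounded by the excesses at the descents, and that of the whole
word in case it ends with a `2`. -/
theorem excess_prefix_le {v : Word} (hv : IsBinary v) {M : ℤ} (hM : 0 ≤ M)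
    (hdes : ∀ k ∈ desSet v, excess (v.take k) ≤ M)
    (hend : ∀ y, v = y ++ [2] → excess v ≤ M) {p : Word} (hp : p <+: v) : excess p ≤ M := by
  induction v using List.reverseRecOn generalizing p with
  | nil =>
    rw [List.prefix_nil.1 hp, excess_nil]
    exact hM
  | append_singleton x a ih =>
    rw [isBinary_append, isBinary_cons] at hv
    have hx : ∀ p, p <+: x → excess p ≤ M := by
      intro p hp
      refine ih hv.1 (fun k hk => ?_) ?_ hp
      · have hk' : k ∈ desSet (x ++ [a]) := by
          rcases List.eq_nil_or_concat x with rfl | ⟨y, b, rfl⟩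
          · simp [desSet_nil] at hk
          · simp only [List.concat_eq_append, List.append_assoc, List.singleton_append] at hk ⊢
            rw [desSet_append_pair]
            split_ifs
            · exact Finset.mem_insert_of_mem hk
            · exact hk
        have := hdes k hk'
        rwa [List.take_append_of_le_length (lt_length_of_mem_desSet hk).le] at this
      -- If `x` ends in 2, then either a 1 follows and `x` is the prefix at a descent, or a 2
      -- follows and the whole word has larger excess.
      · rintro y rfl
        rcases hv.2.1 with rfl | rfl
        · have := hdes (y.length + 1) (by
            rw [List.append_assoc, List.singleton_append,
              desSet_append_two_one (isBinary_append.1 hv.1).1]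
            exact Finset.mem_insert_self _ _)
          rwa [List.take_left' (by simp)] at this
        · have := hend _ rfl
          rw [excess_append, excess_two] at this
          omega
    rcases List.prefix_concat_iff.1 hp with rfl | hp
    · rcases hv.2.1 with rfl | rfl
      · have := hx x List.prefix_rfl
        rw [excess_append, excess_one]
        omega
      · exact hend x rfl
    · exact hx p hp

theorem isBallot_iff_desSet {v : Word} (hv : v ∈ W [2, 1]) :
    IsBallot v ↔ ∀ k ∈ desSet v, excess (v.take k) ≤ 0 := by
  rw [isBallot_iff (isBinary_of_mem_W hv)]
  constructor
  · intro h k _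
    exact h _ (List.take_prefix k v)
  · intro h p hp
    refine excess_prefix_le (isBinary_of_mem_W hv) le_rfl h ?_ hp
    rintro y rfl
    rcases mem_W_cases hv with h' | ⟨u, -, h'⟩
    · simp at h'
    · rw [show u ++ [2, 1] = (u ++ [2]) ++ [1] by simp] at h'
      have := (List.append_inj' h' rfl).2 |> List.singleton_inj.1
      exact absurd this (by decide)

theorem diagram_foata_mem_conj_RGe {v : Word} (hv : v ∈ W [2, 1]) :
    diagram (foata v) ∈ conj (RGe 1) ↔ IsBallot v := by
  rw [isBallot_iff_desSet hv, mem_conj]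
  have h := image_excess_desSet (isBinary_of_mem_W hv)
  have h1 : (∀ k ∈ desSet v, excess (v.take k) ≤ 0) ↔
      ∀ x ∈ (desSet v).image (fun k => excess (v.take k)), x ≤ 0 := by
    simp only [Finset.forall_mem_image]
  rw [h1, h, Finset.forall_mem_image]
  simp only [RGe, Set.mem_ofPred_eq, durfee_transpose, rank_transpose, Finset.mem_range]
  refine forall₂_congr fun i _ => ?_
  omega

/-- A part 1 of the conjugate is a column of height one, and these are the columns where the first
row sticks out beyond the second. -/
theorem one_mem_rowLens_transpose {l : YoungDiagram} :
    1 ∈ l.transpose.rowLens ↔ l.rowLen 1 < l.rowLen 0 := by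
  simp only [YoungDiagram.rowLens, List.mem_map, List.mem_range, YoungDiagram.rowLen_transpose,
    YoungDiagram.colLen_transpose]
  constructor
  · rintro ⟨j, hj, h⟩
    refine lt_of_le_of_lt ?_ hj
    by_contra hlt
    have := YoungDiagram.mem_iff_lt_colLen.1 (YoungDiagram.mem_iff_lt_rowLen.2 (not_le.1 hlt))
    omega
  · intro h
    refine ⟨l.rowLen 1, h, ?_⟩
    have h0 := YoungDiagram.mem_iff_lt_colLen.1 (YoungDiagram.mem_iff_lt_rowLen.2 h)
    by_contra hne
    have h1 : 1 < l.colLen (l.rowLen 1) := by omega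
    have := YoungDiagram.mem_iff_lt_rowLen.1 (YoungDiagram.mem_iff_lt_colLen.2 h1)
    omega

/-- The top two rows have equal length exactly when no east step separates the last two north steps.
For empty `u` the second row is empty. -/
theorem rowLen_one_lt_hook {u : Word} (hu : IsBinary u) :
    (diagram (2 :: u ++ [1])).rowLen 1 < (diagram (2 :: u ++ [1])).rowLen 0 ↔
      ¬ ∃ x, u = x ++ [1] := by
  rw [rowLen_zero_hook, rowLen_diagram, rows_append_one, List.getD_cons_succ, rows_two_cons]
  rcases List.eq_nil_or_concat u with rfl | ⟨x, a, rfl⟩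
  · simp [rows_nil]
  · rw [List.concat_eq_append] at hu ⊢
    rw [isBinary_append, isBinary_cons] at hu
    rcases hu.2.1 with rfl | rfl
    · rw [rows_append_one]
      have : ∃ y, x ++ [(1 : ℕ+)] = y ++ [1] := ⟨x, rfl⟩
      simp
    · rw [rows_append_two]
      constructor
      · rintro - ⟨y, h⟩
        have := (List.append_inj' h rfl).2 |> List.singleton_inj.1
        exact absurd this (by decide)
      · intro _
        rw [List.count_append]
        cases hr : rows x with
        | nil => simp
        | cons y L =>
          have := le_count_of_mem_rows (w := x) (x := y) (by simp [hr])
          simp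
          omega

theorem exists_foata_eq_append_one_iff {v : Word} :
    (∃ x, foata v = x ++ [1]) ↔ ∃ y, v = y ++ [1] := by
  constructor
  · rintro ⟨x, hx⟩
    rcases List.eq_nil_or_concat v with rfl | ⟨y, a, rfl⟩
    · simp [foata_nil] at hx
    · obtain ⟨u, hu⟩ := exists_foata_append_singleton y a
      rw [List.concat_eq_append, hu] at hx
      have := (List.append_inj' hx rfl).2 |> List.singleton_inj.1
      exact ⟨y, by rw [List.concat_eq_append, this]⟩
  · rintro ⟨y, rfl⟩
    exact exists_foata_append_singleton y 1

theorem diagram_foata_mem_conj_PNe {v : Word} (hv : v ∈ W [2, 1]) :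
    diagram (foata v) ∈ conj (PNe 1) ↔ v ∈ W [1, 2, 1] := by
  rw [mem_conj, PNe, Set.mem_ofPred_eq, one_mem_rowLens_transpose]
  rcases mem_W_cases hv with rfl | ⟨u, hu, rfl⟩
  · refine iff_of_true ?_ (nil_mem_W _)
    rw [foata_nil, rowLen_diagram, rowLen_diagram]
    simp [rows_nil]
  · rw [foata_append_two_one hu, rowLen_one_lt_hook (isBinary_foata.2 hu), not_not,
      exists_foata_eq_append_one_iff]
    constructor
    · rintro ⟨y, rfl⟩
      exact .inl ⟨y, (isBinary_append.1 hu).1, by simp⟩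
    · intro h
      rcases mem_W_cases h with h | ⟨y, hy, h⟩
      · simp at h
      · refine ⟨y, ?_⟩
        rw [show y ++ [1, 2, 1] = (y ++ [1]) ++ [2, 1] by simp] at h
        exact List.append_cancel_right h

theorem foata_preimage_univ : foata ⁻¹' (boundaryWord '' Set.univ) = W [2, 1] := by
  ext v
  rw [mem_preimage_foata_iff]
  exact and_iff_left trivial

theorem foata_preimage_RGe : foata ⁻¹' (boundaryWord '' conj (RGe 1)) = B [2, 1] := by
  ext v
  rw [mem_preimage_foata_iff, B, Set.mem_ofPred_eq]
  exact and_congr_right fun hv => diagram_foata_mem_conj_RGe hv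

theorem W_one_two_one_subset : W [1, 2, 1] ⊆ W [2, 1] := by
  intro v hv
  rcases mem_W_cases hv with rfl | ⟨u, hu, rfl⟩
  · exact nil_mem_W _
  · exact .inl ⟨u ++ [1], isBinary_append.2 ⟨hu, isBinary_one⟩, by simp⟩

theorem foata_preimage_PNe : foata ⁻¹' (boundaryWord '' conj (PNe 1)) = W [1, 2, 1] := by
  ext v
  rw [mem_preimage_foata_iff]
  exact ⟨fun h => (diagram_foata_mem_conj_PNe h.1).1 h.2,
    fun h => ⟨W_one_two_one_subset h,
      (diagram_foata_mem_conj_PNe (W_one_two_one_subset h)).2 h⟩⟩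

/-! ### Mahonian pairs and joint distributions -/

theorem bijOn_foata (T : Set YoungDiagram) :
    Set.BijOn foata (foata ⁻¹' (boundaryWord '' T)) (boundaryWord '' T) := by
  refine ⟨fun v hv => hv, fun v hv v' _ h => ?_, ?_⟩
  · exact foata_injOn (isBinary_of_mem_W (mem_preimage_foata_iff.1 hv).1) h
  · rintro _ ⟨l, hl, rfl⟩
    obtain ⟨v, -, h⟩ := exists_mem_W_foata_eq l
    exact ⟨v, ⟨l, hl, h.symm⟩, h⟩

theorem bijOn_diagram (T : Set YoungDiagram) :
    Set.BijOn (fun v => diagram (foata v)) (foata ⁻¹' (boundaryWord '' T)) T := by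
  refine Set.BijOn.comp (t := boundaryWord '' T) (g := diagram) ⟨?_, ?_, ?_⟩ (bijOn_foata T)
  · rintro _ ⟨l, hl, rfl⟩
    rwa [diagram_boundaryWord]
  · rintro _ ⟨l, hl, rfl⟩ _ ⟨m, hm, rfl⟩ h
    rw [diagram_boundaryWord, diagram_boundaryWord] at h
    rw [h]
  · intro l hl
    exact ⟨boundaryWord l, ⟨l, hl, rfl⟩, diagram_boundaryWord l⟩

theorem isMahonianPair_foata (T : Set YoungDiagram) :
    IsMahonianPair (foata ⁻¹' (boundaryWord '' T)) (boundaryWord '' T) :=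
  ⟨(bijOn_foata T).equiv foata, fun v =>
    (inv_foata (isBinary_of_mem_W (mem_preimage_foata_iff.1 v.2).1)).symm⟩

theorem card_diagram_foata {v : Word} (hv : IsBinary v) : (diagram (foata v)).card = maj v := by
  rw [card_diagram (isBinary_foata.2 hv), inv_foata hv]

theorem bijOn_degree {A C : Type*} {S : Set A} {T : Set C} {f : A → C} (hf : Set.BijOn f S T)
    {d : A → ℕ} {d' : C → ℕ} (hd : ∀ x ∈ S, d' (f x) = d x) (n : ℕ) :
    Set.BijOn f {x | x ∈ S ∧ d x = n} {y | y ∈ T ∧ d' y = n} := by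
  refine ⟨fun x hx => ⟨hf.mapsTo hx.1, (hd x hx.1).trans hx.2⟩,
    hf.injOn.mono fun x hx => hx.1, ?_⟩
  rintro y ⟨hy, h⟩
  obtain ⟨x, hx, rfl⟩ := hf.surjOn hy
  exact ⟨x, ⟨hx, (hd x hx).symm.trans h⟩, rfl⟩

theorem converges_of_bijOn {A C : Type*} {S : Set A} {T : Set C} {f : A → C}
    (hf : Set.BijOn f S T) {d : A → ℕ} {d' : C → ℕ} (hd : ∀ x ∈ S, d' (f x) = d x)
    (h : Converges T d') : Converges S d := fun n =>
  (bijOn_degree hf hd n).finite_iff_finite.2 (h n)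

theorem genFun_eq_of_bijOn {A C R : Type*} [CommRing R] {S : Set A} {T : Set C} {f : A → C}
    (hf : Set.BijOn f S T) {d : A → ℕ} {d' : C → ℕ} (hd : ∀ x ∈ S, d' (f x) = d x)
    {wt : A → R} {wt' : C → R} (hwt : ∀ x ∈ S, wt x = wt' (f x)) :
    genFun S d wt = genFun T d' wt' := by
  ext n
  rw [genFun, genFun, PowerSeries.coeff_mk, PowerSeries.coeff_mk]
  exact finsum_mem_eq_of_bijOn f (bijOn_degree hf hd n) fun x hx => hwt x hx.1

theorem converges_card (T : Set YoungDiagram) : Converges T YoungDiagram.card := by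
  intro n
  refine Set.Finite.of_finite_image (f := YoungDiagram.cells) (Set.Finite.subset
    (Finset.finite_toSet (Finset.range n ×ˢ Finset.range n).powerset) ?_) fun l _ m _ h =>
      YoungDiagram.ext h
  rintro _ ⟨l, ⟨-, rfl⟩, rfl⟩
  simp only [Finset.coe_powerset, Set.mem_preimage, Set.mem_powerset_iff, Finset.coe_subset]
  rintro ⟨i, j⟩ h
  have hc : l.colLen j ≤ l.card := by
    rw [YoungDiagram.colLen_eq_card]; exact Finset.card_le_card (Finset.filter_subset _ _)
  have hr : l.rowLen i ≤ l.card := by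
    rw [YoungDiagram.rowLen_eq_card]; exact Finset.card_le_card (Finset.filter_subset _ _)
  rw [Finset.mem_product, Finset.mem_range, Finset.mem_range]
  exact ⟨(YoungDiagram.mem_iff_lt_colLen.1 h).trans_le hc,
    (YoungDiagram.mem_iff_lt_rowLen.1 h).trans_le hr⟩

theorem e_eq_maxRank {v : Word} (hv : v ∈ W [2, 1]) :
    e v = maxRank (diagram (foata v)) + 1 := by
  rcases mem_W_cases hv with rfl | ⟨u, hu, rfl⟩
  · rw [e_nil, foata_nil, diagram_nil, maxRank_bot]
    rfl
  · exact e_append_two_one hu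

theorem card_diagram_foata_of_mem (T : Set YoungDiagram) :
    ∀ v ∈ foata ⁻¹' (boundaryWord '' T), (diagram (foata v)).card = maj v := fun _ hv =>
  card_diagram_foata (isBinary_of_mem_W (mem_preimage_foata_iff.1 hv).1)

theorem joint_distribution (T : Set YoungDiagram) :
    genFun (foata ⁻¹' (boundaryWord '' T)) maj (fun v => tz (des v) (e v)) =
      genFun T YoungDiagram.card fun l => tz (durfee l) (maxRank l + 1) := by
  refine genFun_eq_of_bijOn (bijOn_diagram T) (card_diagram_foata_of_mem T) fun v hv => ?_
  have h := (mem_preimage_foata_iff.1 hv).1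
  rw [durfee_diagram_foata (isBinary_of_mem_W h), e_eq_maxRank h]

/-! ### Words in `W_{21}` as finite sets of positions -/

/-- The excess of the prefix of length `k` of the infinite word in `{1,2}` with twos at the
positions in `A`. -/
def prefixExcess (A : Finset ℕ) (k : ℕ) : ℤ := ∑ i ∈ Finset.range k, if i ∈ A then 1 else -1

/-- The major index of the infinite word in `{1,2}` with twos at the positions in `A`. -/
def setMaj (A : Finset ℕ) : ℕ := ∑ i ∈ A, if i + 1 ∈ A then 0 else i + 1

/-- The positions of the twos in a word. -/
def twos (v : Word) : Finset ℕ := (Finset.range v.length).filter fun i => v.getD i 1 = 2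

/-- The word in `W_{21}` with twos at the positions in `A`. -/
def wordOfTwos (A : Finset ℕ) : Word :=
  if A = ∅ then [] else (List.range (A.sup id + 2)).map fun i => if i ∈ A then 2 else 1

theorem mem_twos {v : Word} {i : ℕ} : i ∈ twos v ↔ v.getD i 1 = 2 := by
  rw [twos, Finset.mem_filter, Finset.mem_range, and_iff_right_iff_imp]
  intro h
  by_contra hi
  rw [List.getD_eq_default _ _ (not_lt.1 hi)] at h
  exact absurd h (by decide)

theorem twos_append_one (v : Word) : twos (v ++ [1]) = twos v := by
  ext i
  rw [mem_twos, mem_twos]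
  rcases lt_trichotomy i v.length with h | h | h
  · rw [List.getD_append _ _ _ _ h]
  · subst h; simp [List.getD_eq_getElem?_getD]
  · rw [List.getD_eq_default _ _ (by simp; omega), List.getD_eq_default _ _ h.le]

theorem twos_append_two (v : Word) : twos (v ++ [2]) = insert v.length (twos v) := by
  ext i
  rw [mem_twos, Finset.mem_insert, mem_twos]
  rcases lt_trichotomy i v.length with h | h | h
  · rw [List.getD_append _ _ _ _ h]
    simp [h.ne]
  · subst h; simp [List.getD_eq_getElem?_getD]
  · rw [List.getD_eq_default _ _ (by simp; omega), List.getD_eq_default _ _ h.le]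
    simp [h.ne']

theorem lt_length_of_mem_twos {v : Word} {i : ℕ} (h : i ∈ twos v) : i < v.length := by
  rw [twos, Finset.mem_filter, Finset.mem_range] at h
  exact h.1

/-- A nonempty word in `W_21` stops one letter after its last 2, so its length is recoverable from
the positions of the twos. This frees the later argument from word lengths. -/
theorem wordOfTwos_twos {v : Word} (hv : v ∈ W [2, 1]) : wordOfTwos (twos v) = v := by
  rcases mem_W_cases hv with rfl | ⟨u, hu, rfl⟩
  · rfl
  · have ht : twos (u ++ [2, 1]) = insert u.length (twos u) := by
      rw [show u ++ [2, 1] = (u ++ [2]) ++ [1] by simp, twos_append_one, twos_append_two]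
    have hsup : (twos (u ++ [2, 1])).sup id = u.length := by
      refine le_antisymm (Finset.sup_le fun i hi => ?_) (Finset.le_sup (f := id) (by simp [ht]))
      rw [ht, Finset.mem_insert] at hi
      rcases hi with rfl | hi
      · exact le_rfl
      · exact (lt_length_of_mem_twos hi).le
    rw [wordOfTwos, if_neg (by rw [ht]; exact Finset.insert_ne_empty _ _), hsup]
    refine List.ext_getElem (by simp) fun i h1 h2 => ?_
    rw [List.getElem_map, List.getElem_range]
    have hb := isBinary_of_mem_W hv _ (List.getElem_mem h2)
    have hg : (u ++ [2, 1]).getD i 1 = (u ++ [2, 1])[i] := by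
      rw [List.getD_eq_getElem?_getD, List.getElem?_eq_getElem h2, Option.getD_some]
    simp only [mem_twos, hg]
    rcases hb with hb | hb
    · rw [hb, if_neg (by decide)]
    · rw [hb, if_pos rfl]

theorem twos_wordOfTwos (A : Finset ℕ) : twos (wordOfTwos A) = A := by
  rw [wordOfTwos]
  split_ifs with hA
  · rw [hA]; rfl
  · ext i
    rw [mem_twos]
    by_cases hi : i < A.sup id + 2
    · simp [List.getD_eq_getElem?_getD, List.getElem?_range hi]
    · rw [List.getD_eq_default _ _ (by simpa using hi)]
      refine iff_of_false (by decide) fun h => hi ?_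
      have : i ≤ A.sup id := Finset.le_sup (f := id) h
      omega

theorem wordOfTwos_mem_W (A : Finset ℕ) : wordOfTwos A ∈ W [2, 1] := by
  rw [wordOfTwos]
  split_ifs with hA
  · exact nil_mem_W _
  · refine .inl ⟨(List.range (A.sup id)).map fun i => if i ∈ A then 2 else 1, ?_, ?_⟩
    · intro a ha
      rw [List.mem_map] at ha
      obtain ⟨i, -, rfl⟩ := ha
      split_ifs <;> simp
    · have h1 : A.sup id ∈ A := by
        obtain ⟨i, hi, h⟩ := Finset.exists_mem_eq_sup A (Finset.nonempty_iff_ne_empty.2 hA) id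
        rw [h]
        exact hi
      have h2 : A.sup id + 1 ∉ A := fun h => by
        have : A.sup id + 1 ≤ A.sup id := Finset.le_sup (f := id) h
        omega
      rw [List.range_succ, List.range_succ, List.map_append, List.map_append]
      simp [h1, h2]

theorem bijOn_twos : Set.BijOn twos (W [2, 1]) Set.univ := by
  refine ⟨fun _ _ => Set.mem_univ _, fun v hv v' hv' h => ?_, fun A _ => ?_⟩
  · rw [← wordOfTwos_twos hv, h, wordOfTwos_twos hv']
  · exact ⟨_, wordOfTwos_mem_W A, twos_wordOfTwos A⟩

theorem setMaj_twos {v : Word} (hv : v ∈ W [2, 1]) : setMaj (twos v) = maj v := by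
  have hb := isBinary_of_mem_W hv
  have hlast : ∀ i ∈ twos v, i + 1 < v.length := by
    intro i hi
    rcases mem_W_cases hv with rfl | ⟨u, hu, rfl⟩
    · simp [twos] at hi
    · rw [show u ++ [2, 1] = (u ++ [2]) ++ [1] by simp, twos_append_one] at hi
      have := lt_length_of_mem_twos hi
      simp at this ⊢
      omega
  -- Descents are numbered from 1 and list positions from 0: a 2 at position `i` followed by a 1 is
  -- the descent `i + 1`.
  have hd : desSet v = ((twos v).filter fun i => i + 1 ∉ twos v).map (addRightEmbedding 1) := by
    ext k
    simp only [desSet, Finset.mem_filter, Finset.mem_Ico, Finset.mem_map, addRightEmbedding_apply]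
    have hletter : ∀ i < v.length, v.getD i 1 = 1 ∨ v.getD i 1 = 2 := by
      intro i hi
      rw [List.getD_eq_getElem?_getD, List.getElem?_eq_getElem hi, Option.getD_some]
      exact hb _ (List.getElem_mem hi)
    constructor
    · rintro ⟨⟨h1, h2⟩, h3⟩
      refine ⟨k - 1, ?_, by omega⟩
      rw [Nat.sub_add_cancel h1, mem_twos, mem_twos]
      rcases hletter k h2 with h | h <;> rcases hletter (k - 1) (by omega) with h' | h' <;>
        rw [h, h'] at h3 ⊢
      · exact absurd h3 (by decide)
      · exact ⟨rfl, by decide⟩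
      · exact absurd h3 (by decide)
      · exact absurd h3 (by decide)
    · rintro ⟨i, ⟨h1, h2⟩, rfl⟩
      have h3 := hlast i h1
      rw [mem_twos] at h1 h2
      refine ⟨⟨by omega, h3⟩, ?_⟩
      rw [Nat.add_sub_cancel, h1, (hletter _ h3).resolve_right h2]
      decide
  rw [maj, hd, Finset.sum_map, Finset.sum_filter, setMaj]
  refine Finset.sum_congr rfl fun i _ => ?_
  rw [ite_not]
  rfl

theorem prefixExcess_zero (A : Finset ℕ) : prefixExcess A 0 = 0 := by simp [prefixExcess]

theorem prefixExcess_succ_of_mem {A : Finset ℕ} {k : ℕ} (h : k ∈ A) :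
    prefixExcess A (k + 1) = prefixExcess A k + 1 := by
  rw [prefixExcess, Finset.sum_range_succ, if_pos h, prefixExcess]

theorem prefixExcess_succ_of_notMem {A : Finset ℕ} {k : ℕ} (h : k ∉ A) :
    prefixExcess A (k + 1) = prefixExcess A k - 1 := by
  rw [prefixExcess, Finset.sum_range_succ, if_neg h, prefixExcess, sub_eq_add_neg]

theorem prefixExcess_twos {v : Word} (hv : IsBinary v) {k : ℕ} (hk : k ≤ v.length) :
    prefixExcess (twos v) k = excess (v.take k) := by
  induction k with
  | zero => rw [prefixExcess_zero, List.take_zero, excess_nil]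
  | succ k ih =>
    have hk' : k < v.length := hk
    rw [List.take_succ_eq_append_getElem hk', excess_append, ← ih hk'.le]
    have hg : v.getD k 1 = v[k] := by
      rw [List.getD_eq_getElem?_getD, List.getElem?_eq_getElem hk', Option.getD_some]
    rcases hv _ (List.getElem_mem hk') with h | h
    · rw [prefixExcess_succ_of_notMem (by rw [mem_twos, hg, h]; decide), h, excess_one,
        sub_eq_add_neg]
    · rw [prefixExcess_succ_of_mem (by rw [mem_twos, hg, h]), h, excess_two]

/-- Beyond the last 2 there are only ones. Maxima over all prefixes of the infinite word are
therefore attained in a finite window. -/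
theorem prefixExcess_strictAnti_of_bound {A : Finset ℕ} {N : ℕ} (hA : ∀ i ∈ A, i < N) {k : ℕ}
    (hk : N < k) : prefixExcess A k < prefixExcess A N := by
  induction k, hk using Nat.le_induction with
  | base =>
    rw [prefixExcess_succ_of_notMem fun h => lt_irrefl _ (hA _ h)]
    omega
  | succ k hk ih =>
    rw [prefixExcess_succ_of_notMem fun h => by have := hA _ h; omega]
    omega

theorem isBallot_iff_twos {v : Word} (hv : v ∈ W [2, 1]) :
    IsBallot v ↔ ∀ k, prefixExcess (twos v) k ≤ 0 := by
  have hb := isBinary_of_mem_W hv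
  rw [isBallot_iff hb]
  constructor
  · intro h k
    rcases le_or_gt k v.length with hk | hk
    · rw [prefixExcess_twos hb hk]
      exact h _ (List.take_prefix k v)
    · refine (prefixExcess_strictAnti_of_bound (fun i hi => lt_length_of_mem_twos hi) hk).le.trans ?_
      rw [prefixExcess_twos hb le_rfl, List.take_length]
      exact h _ List.prefix_rfl
  · intro h p hp
    rw [List.prefix_iff_eq_take.1 hp, ← prefixExcess_twos hb hp.length_le]
    exact h _

theorem bijOn_twos_ballot :
    Set.BijOn twos (B [2, 1]) {A | ∀ k, prefixExcess A k ≤ 0} := by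
  refine ⟨fun v hv => (isBallot_iff_twos hv.1).1 hv.2,
    bijOn_twos.injOn.mono fun v hv => hv.1, fun A hA => ?_⟩
  obtain ⟨v, hv, rfl⟩ := bijOn_twos.surjOn (Set.mem_univ A)
  exact ⟨v, ⟨hv, (isBallot_iff_twos hv).2 hA⟩, rfl⟩

/-! ### Removing the two before the first maximal excess -/

/-- The excess is maximal for the last time after `m` letters. -/
def IsLastMax (A : Finset ℕ) (m : ℕ) : Prop :=
  (∀ j ≤ m, prefixExcess A j ≤ prefixExcess A m) ∧ ∀ j > m, prefixExcess A j < prefixExcess A m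

/-- The excess is maximal for the first time after `m + 1` letters. -/
def IsPeak (A : Finset ℕ) (m : ℕ) : Prop :=
  (∀ j ≤ m, prefixExcess A j < prefixExcess A (m + 1)) ∧
    ∀ j > m, prefixExcess A j ≤ prefixExcess A (m + 1)

theorem exists_last_max (f : ℕ → ℤ) (N : ℕ) :
    ∃ m ≤ N, (∀ j ≤ m, f j ≤ f m) ∧ ∀ j, m < j → j ≤ N → f j < f m := by
  induction N with
  | zero => exact ⟨0, le_rfl, fun j hj => by rw [Nat.le_zero.1 hj], fun j h h' => by omega⟩
  | succ N ih =>
    obtain ⟨m, hm, h1, h2⟩ := ih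
    rcases lt_or_ge (f (N + 1)) (f m) with h | h
    · refine ⟨m, by omega, h1, fun j hj hj' => ?_⟩
      rcases Nat.le_succ_iff.1 hj' with h' | rfl
      · exact h2 j hj h'
      · exact h
    · refine ⟨N + 1, le_rfl, fun j hj => ?_, fun j h h' => by omega⟩
      rcases Nat.le_succ_iff.1 hj with h' | rfl
      · rcases le_or_gt j m with h'' | h''
        · exact (h1 j h'').trans h
        · exact (h2 j h'' h').le.trans h
      · exact le_rfl

theorem exists_first_max (f : ℕ → ℤ) (N : ℕ) :
    ∃ m ≤ N, (∀ j < m, f j < f m) ∧ ∀ j ≤ N, f j ≤ f m := by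
  induction N with
  | zero => exact ⟨0, le_rfl, fun j hj => by omega, fun j h => by rw [Nat.le_zero.1 h]⟩
  | succ N ih =>
    obtain ⟨m, hm, h1, h2⟩ := ih
    rcases le_or_gt (f (N + 1)) (f m) with h | h
    · refine ⟨m, by omega, h1, fun j hj => ?_⟩
      rcases Nat.le_succ_iff.1 hj with h' | rfl
      · exact h2 j h'
      · exact h
    · refine ⟨N + 1, le_rfl, fun j hj => (h2 j (by omega)).trans_lt h, fun j hj => ?_⟩
      rcases Nat.le_succ_iff.1 hj with h' | rfl
      · exact (h2 j h').trans h.le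
      · exact le_rfl

theorem exists_bound (A : Finset ℕ) : ∃ N, ∀ i ∈ A, i < N :=
  ⟨A.sup id + 1, fun _ hi => Nat.lt_succ_of_le (Finset.le_sup (f := id) hi)⟩

theorem exists_isLastMax (A : Finset ℕ) : ∃ m, IsLastMax A m := by
  obtain ⟨N, hN⟩ := exists_bound A
  obtain ⟨m, hm, h1, h2⟩ := exists_last_max (prefixExcess A) N
  refine ⟨m, h1, fun j hj => ?_⟩
  rcases le_or_gt j N with h | h
  · exact h2 j hj h
  · refine (prefixExcess_strictAnti_of_bound hN h).trans_le ?_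
    rcases hm.eq_or_lt with rfl | hm
    · exact le_rfl
    · exact (h2 N hm le_rfl).le

theorem exists_isPeak {A : Finset ℕ} {k : ℕ} (hk : 0 < prefixExcess A k) : ∃ m, IsPeak A m := by
  obtain ⟨N, hN⟩ := exists_bound A
  obtain ⟨m, hm, h1, h2⟩ := exists_first_max (prefixExcess A) N
  have h3 : ∀ j, prefixExcess A j ≤ prefixExcess A m := by
    intro j
    rcases le_or_gt j N with h | h
    · exact h2 j h
    · exact (prefixExcess_strictAnti_of_bound hN h).le.trans (h2 N le_rfl)
  -- A first maximum at 0 would have value 0, against `hk`; a positive index supplies the letter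
  -- just before the peak.
  rcases m with _ | m
  · have := h3 k
    rw [prefixExcess_zero] at this
    omega
  · exact ⟨m, fun j hj => h1 j (Nat.lt_succ_of_le hj), fun j _ => h3 j⟩

theorem IsLastMax.unique {A : Finset ℕ} {m m' : ℕ} (h : IsLastMax A m) (h' : IsLastMax A m') :
    m = m' := by
  rcases lt_trichotomy m m' with hlt | heq | hlt
  · exact absurd (h.2 _ hlt) (not_lt.2 (h'.1 _ hlt.le))
  · exact heq
  · exact absurd (h'.2 _ hlt) (not_lt.2 (h.1 _ hlt.le))

theorem IsPeak.unique {A : Finset ℕ} {m m' : ℕ} (h : IsPeak A m) (h' : IsPeak A m') : m = m' := by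
  rcases lt_trichotomy m m' with hlt | heq | hlt
  · exact absurd (h'.1 (m + 1) hlt) (not_lt.2 (h.2 (m' + 1) (by omega)))
  · exact heq
  · exact absurd (h.1 (m' + 1) hlt) (not_lt.2 (h'.2 (m + 1) (by omega)))

theorem prefixExcess_insert {A : Finset ℕ} {m : ℕ} (hm : m ∉ A) (k : ℕ) :
    prefixExcess (insert m A) k = prefixExcess A k + if m < k then 2 else 0 := by
  induction k with
  | zero => simp [prefixExcess_zero]
  | succ k ih =>
    rcases eq_or_ne k m with rfl | hne
    · rw [prefixExcess_succ_of_mem (Finset.mem_insert_self _ _), prefixExcess_succ_of_notMem hm, ih,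
        if_neg (lt_irrefl _), if_pos (Nat.lt_succ_self _)]
      ring
    · have h1 : (m < k + 1) ↔ m < k := by omega
      simp only [h1]
      by_cases hk : k ∈ A
      · rw [prefixExcess_succ_of_mem (Finset.mem_insert_of_mem hk), prefixExcess_succ_of_mem hk, ih]
        ring
      · rw [prefixExcess_succ_of_notMem (by simp [hk, hne]), prefixExcess_succ_of_notMem hk, ih]
        ring

theorem IsLastMax.notMem {A : Finset ℕ} {m : ℕ} (h : IsLastMax A m) : m ∉ A := fun hm => by
  have := h.2 (m + 1) (Nat.lt_succ_self m)
  rw [prefixExcess_succ_of_mem hm] at this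
  omega

theorem IsPeak.mem {A : Finset ℕ} {m : ℕ} (h : IsPeak A m) : m ∈ A := by
  by_contra hm
  have := h.1 m le_rfl
  rw [prefixExcess_succ_of_notMem hm] at this
  omega

/-- Changing the letter at `m` to 2 adds 2 to all later excesses, so the excess after `m + 1`
letters becomes the old excess at `m` plus one. Weak and strict inequalities trade places on the two
sides of `m`. -/
theorem isPeak_insert_iff {A : Finset ℕ} {m : ℕ} (hm : m ∉ A) :
    IsPeak (insert m A) m ↔ IsLastMax A m := by
  have hs := prefixExcess_succ_of_notMem hm
  simp only [IsPeak, IsLastMax, prefixExcess_insert hm, hs, Nat.lt_succ_self, if_true]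
  refine and_congr (forall₂_congr fun j hj => ?_) (forall₂_congr fun j hj => ?_)
  · rw [if_neg (not_lt.2 hj)]
    omega
  · rw [if_pos hj]
    omega

/-- Around the last maximum the letters at `m` and `m + 1` are ones, and the letter before `m`, if
any, is a 2. The insertion thus moves a descent from `m` to `m + 1`, or creates the descent 1 when
`m = 0`. -/
theorem setMaj_insert {A : Finset ℕ} {m : ℕ} (h : IsLastMax A m) :
    setMaj (insert m A) = setMaj A + 1 := by
  have hm := h.notMem
  have hm1 : m + 1 ∉ A := fun hm1 => by
    have := h.2 (m + 2) (by omega)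
    rw [prefixExcess_succ_of_mem hm1, prefixExcess_succ_of_notMem hm] at this
    omega
  rw [setMaj, Finset.sum_insert hm, if_neg (by simp [hm1]), setMaj]
  rcases m with _ | p
  · rw [add_comm]
    congr 1
    refine Finset.sum_congr rfl fun i _ => ?_
    simp
  · have hp : p ∈ A := by
      by_contra hp
      have := h.1 p (Nat.le_succ p)
      rw [prefixExcess_succ_of_notMem hp] at this
      omega
    rw [← Finset.add_sum_erase A _ hp, ← Finset.add_sum_erase A _ hp,
      if_pos (Finset.mem_insert_self _ _), if_neg hm]
    have : ∑ i ∈ A.erase p, (if i + 1 ∈ insert (p + 1) A then 0 else i + 1) =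
        ∑ i ∈ A.erase p, if i + 1 ∈ A then 0 else i + 1 := by
      refine Finset.sum_congr rfl fun i hi => ?_
      have hne := Finset.ne_of_mem_erase hi
      simp [hne]
    rw [this]
    omega

/-- Turn the letter after the last maximal excess into a two. -/
noncomputable def raise (A : Finset ℕ) : Finset ℕ := insert (exists_isLastMax A).choose A

/-- The inserted position is the unique peak of the result, so it can be found and erased again. A
peak exists precisely when some excess is positive, that is, when the ballot condition fails. -/
theorem bijOn_raise :
    Set.BijOn raise Set.univ (Set.univ \ {A | ∀ k, prefixExcess A k ≤ 0}) := by
  have hpeak : ∀ A, IsPeak (raise A) (exists_isLastMax A).choose := fun A =>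
    (isPeak_insert_iff (exists_isLastMax A).choose_spec.notMem).2 (exists_isLastMax A).choose_spec
  refine ⟨fun A _ => ⟨trivial, fun h => ?_⟩, fun A _ A' _ h => ?_, ?_⟩
  · have h1 := (hpeak A).1 0 (Nat.zero_le _)
    have h2 := h ((exists_isLastMax A).choose + 1)
    rw [prefixExcess_zero] at h1
    omega
  · have h1 := hpeak A
    rw [h] at h1
    have h2 := h1.unique (hpeak A')
    have h3 := (exists_isLastMax A).choose_spec.notMem
    have h4 := (exists_isLastMax A').choose_spec.notMem
    rw [raise, raise, ← h2] at h
    rw [← h2] at h4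
    rw [← Finset.erase_insert h3, h, Finset.erase_insert h4]
  · rintro C ⟨-, hC⟩
    simp only [Set.mem_ofPred_eq, not_forall, not_le] at hC
    obtain ⟨k, hk⟩ := hC
    obtain ⟨m, hm⟩ := exists_isPeak hk
    have hins := Finset.insert_erase hm.mem
    have hlast : IsLastMax (C.erase m) m := by
      rw [← isPeak_insert_iff (Finset.notMem_erase m C), hins]
      exact hm
    refine ⟨C.erase m, trivial, ?_⟩
    rw [raise, (exists_isLastMax (C.erase m)).choose_spec.unique hlast, hins]

theorem setMaj_raise (A : Finset ℕ) : setMaj (raise A) = setMaj A + 1 :=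
  setMaj_insert (exists_isLastMax A).choose_spec

/-! ### Generating functions -/

/-- `S` splits into `S'` and a copy of `S` shifted up one degree. -/
theorem genFun_diff_of_bijOn {A R : Type*} [CommRing R] {S S' : Set A} (hS : S' ⊆ S) {d : A → ℕ}
    (hc : Converges S d) {g : A → A} (hg : Set.BijOn g S (S \ S'))
    (hd : ∀ x ∈ S, d (g x) = d x + 1) :
    genFun S d (fun _ => (1 : R)) =
      genFun S' d (fun _ => (1 : R)) + PowerSeries.X * genFun S d fun _ => (1 : R) := by
  ext n
  have hunion : {x | x ∈ S ∧ d x = n} = {x | x ∈ S' ∧ d x = n} ∪ {x | x ∈ S \ S' ∧ d x = n} := by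
    ext x
    have := @hS x
    simp only [Set.mem_ofPred_eq, Set.mem_union, Set.mem_sdiff]
    tauto
  have hdisj : Disjoint {x | x ∈ S' ∧ d x = n} {x | x ∈ S \ S' ∧ d x = n} :=
    Set.disjoint_left.2 fun x h h' => h'.1.2 h.1
  rw [map_add, genFun, genFun, PowerSeries.coeff_mk, PowerSeries.coeff_mk, hunion,
    finsum_mem_union hdisj ((hc n).subset fun x hx => ⟨hS hx.1, hx.2⟩)
      ((hc n).subset fun x hx => ⟨hx.1.1, hx.2⟩)]
  congr 1
  cases n with
  | zero =>
    rw [PowerSeries.coeff_zero_X_mul]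
    have : {x | x ∈ S \ S' ∧ d x = 0} = ∅ := by
      refine Set.eq_empty_of_forall_notMem ?_
      rintro x ⟨hx, h0⟩
      obtain ⟨y, hy, rfl⟩ := hg.surjOn hx
      rw [hd y hy] at h0
      omega
    rw [this, finsum_mem_empty]
  | succ n =>
    rw [PowerSeries.coeff_succ_X_mul, PowerSeries.coeff_mk]
    have := bijOn_degree hg (d := fun x => d x + 1) (d' := d) hd (n + 1)
    simp only [add_left_inj] at this
    exact (finsum_mem_eq_of_bijOn g this fun _ _ => rfl).symm

theorem converges_maj (T : Set YoungDiagram) : Converges (foata ⁻¹' (boundaryWord '' T)) maj :=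
  converges_of_bijOn (bijOn_diagram T) (card_diagram_foata_of_mem T) (converges_card T)

theorem converges_setMaj : Converges Set.univ setMaj := by
  intro n
  rw [← (bijOn_degree bijOn_twos (d := maj) (d' := setMaj) (fun v hv => setMaj_twos hv)
    n).finite_iff_finite, ← foata_preimage_univ]
  exact converges_maj _ n

theorem genFun_maj_ballot :
    genFun (W [2, 1]) maj (fun _ => (1 : ℤ)) =
      genFun (B [2, 1]) maj (fun _ => (1 : ℤ)) +
        PowerSeries.X * genFun (W [2, 1]) maj fun _ => (1 : ℤ) := by
  rw [genFun_eq_of_bijOn bijOn_twos (fun v hv => setMaj_twos hv) (wt' := fun _ => 1)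
      (fun _ _ => rfl),
    genFun_eq_of_bijOn bijOn_twos_ballot (fun v hv => setMaj_twos hv.1) (wt' := fun _ => 1)
      (fun _ _ => rfl)]
  exact genFun_diff_of_bijOn (Set.subset_univ _) converges_setMaj bijOn_raise
    fun A _ => setMaj_raise A

/-- Sends `u21` to `u221` and the empty word to `21`. The words of `W_21` outside `W_121` are those
`u21` with `u` empty or ending in 2. -/
theorem bijOn_double_last_two :
    Set.BijOn (fun w : Word => w.dropLast ++ [2, 1]) (W [2, 1]) (W [2, 1] \ W [1, 2, 1]) := by
  have hd : ∀ u : Word, (u ++ [2, 1]).dropLast ++ [2, 1] = u ++ [2] ++ [2, 1] := by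
    intro u
    rw [show u ++ [2, 1] = (u ++ [2]) ++ [1] by simp, List.dropLast_concat]
  have hnot : ∀ x : Word, (∀ y, x ≠ y ++ [1]) → x ++ [2, 1] ∉ W [1, 2, 1] := by
    intro x hx h
    rcases mem_W_cases h with h | ⟨y, -, h⟩
    · simp at h
    · rw [show y ++ [1, 2, 1] = (y ++ [1]) ++ [2, 1] by simp] at h
      exact hx y (List.append_cancel_right h)
  refine ⟨?_, ?_, ?_⟩
  · intro v hv
    rcases mem_W_cases hv with rfl | ⟨u, hu, rfl⟩
    · exact ⟨append_two_one_mem_W isBinary_nil, hnot [] (by simp)⟩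
    · simp only [hd]
      refine ⟨append_two_one_mem_W (isBinary_append.2 ⟨hu, isBinary_two⟩), hnot _ fun y h => ?_⟩
      have := (List.append_inj' h rfl).2 |> List.singleton_inj.1
      exact absurd this (by decide)
  · intro v hv v' hv' h
    rcases mem_W_cases hv with rfl | ⟨u, hu, rfl⟩ <;>
      rcases mem_W_cases hv' with rfl | ⟨u', hu', rfl⟩
    · rfl
    · simp only [hd] at h
      simpa using congrArg List.length h
    · simp only [hd] at h
      simpa using congrArg List.length h
    · simp only [hd] at h
      rw [List.append_cancel_right (List.append_cancel_right h)]
  · rintro v ⟨hv, hv'⟩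
    rcases mem_W_cases hv with rfl | ⟨u, hu, rfl⟩
    · exact absurd (nil_mem_W _) hv'
    · rcases List.eq_nil_or_concat u with rfl | ⟨x, a, rfl⟩
      · exact ⟨[], nil_mem_W _, rfl⟩
      · rw [List.concat_eq_append] at hu hv' ⊢
        rw [isBinary_append, isBinary_cons] at hu
        rcases hu.2.1 with rfl | rfl
        · exact absurd (.inl ⟨x, hu.1, by simp⟩) hv'
        · exact ⟨x ++ [2, 1], append_two_one_mem_W hu.1, hd x⟩

theorem maj_double_last_two {v : Word} (hv : v ∈ W [2, 1]) :
    maj (v.dropLast ++ [2, 1]) = maj v + 1 := by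
  rcases mem_W_cases hv with rfl | ⟨u, hu, rfl⟩
  · decide
  · rw [show u ++ [2, 1] = (u ++ [2]) ++ [1] by simp, List.dropLast_concat,
      maj_append_two_one (isBinary_append.2 ⟨hu, isBinary_two⟩), List.append_assoc,
      List.singleton_append, maj_append_two_one hu, maj, desSet_append_two hu, ← maj]
    simp
    omega

theorem genFun_maj_W_one_two_one :
    genFun (W [2, 1]) maj (fun _ => (1 : ℤ)) =
      genFun (W [1, 2, 1]) maj (fun _ => (1 : ℤ)) +
        PowerSeries.X * genFun (W [2, 1]) maj fun _ => (1 : ℤ) := by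
  refine genFun_diff_of_bijOn W_one_two_one_subset ?_ bijOn_double_last_two
    fun v hv => maj_double_last_two hv
  rw [← foata_preimage_univ]
  exact converges_maj _

theorem genFun_maj_ballot_eq :
    genFun (B [2, 1]) maj (fun _ => (1 : ℤ)) = genFun (W [1, 2, 1]) maj (fun _ => (1 : ℤ)) :=
  add_right_cancel (genFun_maj_ballot.symm.trans genFun_maj_W_one_two_one)

/-! ### Partitions without a given part and the product formula -/

theorem card_transpose (l : YoungDiagram) : l.transpose.card = l.card :=
  Finset.card_map _

theorem bijOn_transpose (L : Set YoungDiagram) : Set.BijOn YoungDiagram.transpose L (conj L) :=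
  (YoungDiagram.transposeOrderIso.injective.injOn).bijOn_image

theorem sum_rowLens (l : YoungDiagram) : l.rowLens.sum = l.card := by
  rw [← card_cellsOfRowLens]
  exact congrArg YoungDiagram.card YoungDiagram.ofRowLens_to_rowLens_eq_self

/-- The Ferrers diagram of a partition given by the multiset of its parts. -/
def ferrers {n : ℕ} (p : n.Partition) : YoungDiagram :=
  YoungDiagram.ofRowLens (p.parts.sort (· ≥ ·)) (p.parts.pairwise_sort (· ≥ ·)).sortedGE

theorem rowLens_ferrers {n : ℕ} (p : n.Partition) :
    (ferrers p).rowLens = p.parts.sort (· ≥ ·) :=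
  YoungDiagram.rowLens_ofRowLens_eq_self fun x hx => p.parts_pos (by simpa using hx)

theorem bijOn_ferrers (n t : ℕ) :
    Set.BijOn ferrers (Nat.Partition.restricted n (· ≠ t) : Set n.Partition)
      {l | l ∈ PNe t ∧ l.card = n} := by
  have hparts : ∀ p : n.Partition, ((ferrers p).rowLens : Multiset ℕ) = p.parts := fun p => by
    rw [rowLens_ferrers, Multiset.sort_eq]
  refine ⟨fun p hp => ⟨?_, ?_⟩, fun p _ p' _ h => ?_, ?_⟩
  · simp only [Nat.Partition.restricted, Finset.coe_filter, Finset.mem_univ, true_and,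
      Set.mem_ofPred_eq] at hp
    intro ht
    exact hp t (by rw [← hparts p]; exact ht) rfl
  · rw [← sum_rowLens, ← Multiset.sum_coe, hparts, p.parts_sum]
  · ext1
    rw [← hparts p, h, hparts]
  · rintro l ⟨hl, rfl⟩
    refine ⟨⟨l.rowLens, fun {i} hi => l.pos_of_mem_rowLens i hi, sum_rowLens l⟩, ?_, ?_⟩
    · simp only [Nat.Partition.restricted, Finset.coe_filter, Finset.mem_univ, true_and,
        Set.mem_ofPred_eq]
      rintro i hi rfl
      exact hl hi
    · refine YoungDiagram.equivListRowLens.injective (Subtype.ext ?_)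
      rw [YoungDiagram.equivListRowLens_apply_coe, YoungDiagram.equivListRowLens_apply_coe,
        rowLens_ferrers, Multiset.coe_sort]
      exact List.mergeSort_eq_self _ l.rowLens_sorted.pairwise

theorem genFun_PNe (t : ℕ) :
    genFun (PNe t) YoungDiagram.card (fun _ => (1 : ℤ)) =
      PowerSeries.mk fun n => ((Nat.Partition.restricted n (· ≠ t)).card : ℤ) := by
  ext n
  rw [genFun, PowerSeries.coeff_mk, PowerSeries.coeff_mk,
    ← finsum_mem_eq_of_bijOn ferrers (bijOn_ferrers n t) (f := fun _ => (1 : ℤ)) fun _ _ => rfl,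
    finsum_mem_coe_finset]
  simp

theorem genFun_maj_eq_genFun_PNe :
    genFun (W [1, 2, 1]) maj (fun _ => (1 : ℤ)) =
      genFun (PNe 1) YoungDiagram.card fun _ => (1 : ℤ) := by
  rw [← foata_preimage_PNe, genFun_eq_of_bijOn (bijOn_diagram _) (card_diagram_foata_of_mem _)
      (wt' := fun _ => 1) (fun _ _ => rfl)]
  exact (genFun_eq_of_bijOn (bijOn_transpose _) (fun l _ => card_transpose l)
    (fun _ _ => rfl)).symm

theorem tsum_X_pow_mul (i : ℕ) :
    ∑' j : ℕ, (PowerSeries.X : ℤ⟦X⟧) ^ ((i + 1) * j) =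
      PowerSeries.invOfUnit (1 - PowerSeries.X ^ (i + 1) : ℤ⟦X⟧) 1 := by
  have h1 : PowerSeries.constantCoeff (1 - PowerSeries.X ^ (i + 1) : ℤ⟦X⟧) = ((1 : ℤˣ) : ℤ) := by
    simp
  have h2 := PowerSeries.mul_invOfUnit _ _ h1
  have h3 : (∑' j : ℕ, (PowerSeries.X : ℤ⟦X⟧) ^ ((i + 1) * j)) *
      (1 - PowerSeries.X ^ (i + 1)) = 1 := by
    simp_rw [pow_mul]
    exact PowerSeries.WithPiTopology.tsum_pow_mul_one_sub_of_constantCoeff_eq_zero (by simp)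
  exact left_inv_eq_right_inv h3 h2

theorem hasProd_genFun_W_one_two_one :
    HasProd (fun i : ℕ => PowerSeries.invOfUnit (1 - PowerSeries.X ^ (i + 2) : ℤ⟦X⟧) 1)
      (genFun (W [1, 2, 1]) maj (fun _ => (1 : ℤ))) := by
  have h := Nat.Partition.hasProd_powerSeriesMk_card_restricted ℤ (· ≠ 1)
  rw [genFun_maj_eq_genFun_PNe, genFun_PNe]
  -- The factor with index 0 belongs to part size 1 and is trivial, so the product may start at part
  -- size 2.
  rw [← Function.Injective.hasProd_iff (add_left_injective 1)] at h
  · have hf : (fun i : ℕ => PowerSeries.invOfUnit (1 - PowerSeries.X ^ (i + 2) : ℤ⟦X⟧) 1) =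
        (fun i => if i + 1 ≠ 1 then ∑' j : ℕ, (PowerSeries.X : ℤ⟦X⟧) ^ ((i + 1) * j) else 1) ∘
          fun i => i + 1 :=
      funext fun i => by rw [Function.comp_apply, if_pos (by omega), tsum_X_pow_mul]
    rw [hf]
    exact h
  · intro i hi
    cases i with
    | zero => simp
    | succ i => exact absurd ⟨i, rfl⟩ hi

end MahonianPairs

theorem mainTheorem2 :
    -- the preimages under Foata's map
    (foata ⁻¹' (boundaryWord '' Set.univ) = W [2, 1] ∧
      foata ⁻¹' (boundaryWord '' conj (RGe 1)) = B [2, 1] ∧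
      foata ⁻¹' (boundaryWord '' conj (PNe 1)) = W [1, 2, 1]) ∧
    -- the Mahonian pairs and the joint distributions
    (∀ (S : Set Word) (T : Set YoungDiagram),
      (S, T) ∈ ({(W [2, 1], Set.univ), (B [2, 1], conj (RGe 1)), (W [1, 2, 1], conj (PNe 1))} :
        Set (Set Word × Set YoungDiagram)) →
      IsMahonianPair S (boundaryWord '' T) ∧
      Converges S maj ∧ Converges T YoungDiagram.card ∧
      genFun S maj (fun v => tz (des v) (e v)) =
        genFun T YoungDiagram.card (fun l => tz (durfee l) (maxRank l + 1))) ∧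
    -- the generating functions of `maj`; the factors are `1 / (1 - q^(i+2))` for `i = 0, 1, …`
    genFun (B [2, 1]) maj (fun _ => (1 : ℤ)) = genFun (W [1, 2, 1]) maj (fun _ => (1 : ℤ)) ∧
    HasProd (fun i : ℕ => PowerSeries.invOfUnit (1 - PowerSeries.X ^ (i + 2) : ℤ⟦X⟧) 1)
      (genFun (W [1, 2, 1]) maj (fun _ => (1 : ℤ))) := by
  refine ⟨⟨foata_preimage_univ, foata_preimage_RGe, foata_preimage_PNe⟩, fun S T hST => ?_,
    genFun_maj_ballot_eq, hasProd_genFun_W_one_two_one⟩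
  have hS : S = foata ⁻¹' (boundaryWord '' T) := by
    simp only [Set.mem_insert_iff, Set.mem_singleton_iff, Prod.mk.injEq] at hST
    rcases hST with ⟨rfl, rfl⟩ | ⟨rfl, rfl⟩ | ⟨rfl, rfl⟩
    · exact foata_preimage_univ.symm
    · exact foata_preimage_RGe.symm
    · exact foata_preimage_PNe.symm
  subst hS
  exact ⟨isMahonianPair_foata T, converges_maj T, converges_card T, joint_distribution T⟩
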